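/- All graphs are finite, simple and undirected. For an integer $t\ge 0$ and a connected graph $G$ with an arbitrary edge-coloring $c:E(G)\to\{1,\dots,t\}$ (adjacent edges may share a color), a tree contained in $G$ is \emph{rainbow} if no two of its edges have the same color. The \emph{$3$-rainbow index} $rx_3(G)$ is the minimum number $t$ of colors for which there is an edge-coloring of $G$ such that every set of three vertices of $G$ is contained in a rainbow tree of $G$. Let $\delta(G)$ be the minimum degree and $diam(G)$ the diameter of $G$, and let $N(v)$ be the set of neighbors of $v$. A graph $G$ is a \emph{threshold graph} if there are $w:V(G)\to\mathbb R$ and $\tau\in\mathbb R$ such that distinct vertices $u,v$ are adjacent if and only if $w(u)+w(v)\ge\tau$; a \emph{chain graph} if it is bipartite with parts $A,B$ and the vertices of $A$ can be ordered as $a_1,\dots,a_k$ with $N(a_1)\subseteq\dots\subseteq N(a_k)$; an \emph{interval graph} if it is the intersection graph of a family of (nonempty) intervals on the real line. Let $G$ be a connected graph with $\delta(G)\ge 3$. (1) If $G$ is a threshold graph, then $rx_3(G)\le 5$. (2) If $G$ is a chain graph, then $rx_3(G)\le 6$. (3) If $G$ is an interval graph, then $diam(G)\le rx_3(G)\le diam(G)+4$.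 Moreover, all three upper bounds are tight, i.e. attained: (1') for every $t\ge 2\cdot 4^3+1$, the graph on $y_1,y_2,y_3,x_1,\dots,x_t$ in which each $y_i$ is adjacent to all other vertices and the $x_j$ are pairwise nonadjacent is a connected threshold graph with $\delta\ge 3$ and $rx_3=5$; (2') for all $k\ge 3$ and $t\ge 2\cdot 5^3+4$, the bipartite graph with parts $\{a_1,\dots,a_k\}$ and $\{b_1,\dots,b_t\}$ in which $N(a_i)=\{b_1,b_2,b_3\}$ for $i\le k-3$ and $N(a_{k-2})=N(a_{k-1})=N(a_k)=\{b_1,\dots,b_t\}$ is a connected chain graph with $\delta\ge 3$ and $rx_3=6$; (3') for every $t\ge 2\cdot 5^6+1$, the graph consisting of $t$ copies of $K_4$ that share exactly one common vertex is a connected interval graph with $\delta\ge 3$, $diam=2$ and $rx_3=diam+4$. -/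

import Mathlib

namespace RainbowIndex

variable {V : Type*}

/-- In the edge-coloured graph `(G, c)`, no two edges of the subgraph `T` share a colour. -/
def IsRainbow {G : SimpleGraph V} {t : ℕ} (c : G.edgeSet → Fin t) (T : G.Subgraph) : Prop :=
  ∀ e f : G.edgeSet, (e : Sym2 V) ∈ T.edgeSet → (f : Sym2 V) ∈ T.edgeSet → c e = c f → e = f

/-- A rainbow `S`-tree: a subgraph of `G` that is a tree, contains all vertices of `S`,
and is rainbow. -/
structure IsRainbowTree {G : SimpleGraph V} {t : ℕ} (c : G.edgeSet → Fin t) (S : Finset V)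
    (T : G.Subgraph) : Prop where
  isTree : T.coe.IsTree
  subset_verts : (S : Set V) ⊆ T.verts
  isRainbow : IsRainbow c T

/-- A `k`-rainbow colouring: every set of `k` vertices is contained in some rainbow tree.
The colouring is an arbitrary map on the edges; adjacent edges may have the same colour. -/
def IsRainbowColoring {G : SimpleGraph V} {t : ℕ} (k : ℕ) (c : G.edgeSet → Fin t) : Prop :=
  ∀ S : Finset V, S.card = k → ∃ T : G.Subgraph, IsRainbowTree c S T

/-- The `k`-rainbow index `rx_k(G)`: the least number `t` of colours in a `k`-rainbow colouring
of `G`. It is `⊤` if there is no such colouring with finitely many colours. -/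
noncomputable def rainbowIndex (k : ℕ) (G : SimpleGraph V) : ℕ∞ :=
  ⨅ (t : ℕ) (_ : ∃ c : G.edgeSet → Fin t, IsRainbowColoring k c), (t : ℕ∞)

/-- Threshold graph: there are real weights `w` and a threshold `t` such that two vertices
are adjacent iff their weights sum to at least `t`. -/
def IsThresholdGraph (G : SimpleGraph V) : Prop :=
  ∃ (w : V → ℝ) (t : ℝ), ∀ u v : V, u ≠ v → (G.Adj u v ↔ t ≤ w u + w v)

/-- Chain graph: a bipartite graph with parts `A`, `B` in which the vertices of `A` can be listed
as `a₁, …, aₖ` with `N(a₁) ⊆ … ⊆ N(aₖ)`. -/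
def IsChainGraph (G : SimpleGraph V) : Prop :=
  ∃ A B : Set V, G.IsBipartiteWith A B ∧ A ∪ B = Set.univ ∧
    ∃ (k : ℕ) (a : Fin k → V), Function.Injective a ∧ Set.range a = A ∧
      Monotone fun i => G.neighborSet (a i)

/-- Interval graph: the intersection graph of nonempty intervals of the real line
(open, closed, half-open, bounded or not: the nonempty order-connected sets). -/
def IsIntervalGraph (G : SimpleGraph V) : Prop :=
  ∃ I : V → Set ℝ, (∀ v, (I v).Nonempty ∧ (I v).OrdConnected) ∧
    ∀ u v : V, u ≠ v → (G.Adj u v ↔ (I u ∩ I v).Nonempty)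

/-- The graph on `y₁, y₂, y₃` (left) and `x₁, …, xₜ` (right) in which the `yᵢ` are adjacent to
all other vertices and the `xⱼ` are pairwise nonadjacent. -/
def thresholdExample (t : ℕ) : SimpleGraph (Fin 3 ⊕ Fin t) where
  Adj u v := u ≠ v ∧ (u.isLeft ∨ v.isLeft)
  symm := ⟨fun _ _ h => ⟨h.1.symm, h.2.symm⟩⟩
  loopless := ⟨fun _ h => h.1 rfl⟩

instance (t : ℕ) : DecidableRel (thresholdExample t).Adj := fun u v =>
  inferInstanceAs (Decidable (u ≠ v ∧ (u.isLeft ∨ v.isLeft)))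

/-- Adjacency of `aᵢ` (left) and `bⱼ` (right) in `chainExample`, with 0-based indices:
`bⱼ` is one of the first three `b`'s, or `aᵢ` is one of the last three `a`'s. -/
def chainAdj (k t : ℕ) : Fin k ⊕ Fin t → Fin k ⊕ Fin t → Prop
  | .inl i, .inr j => (j : ℕ) < 3 ∨ k ≤ (i : ℕ) + 3
  | .inr j, .inl i => (j : ℕ) < 3 ∨ k ≤ (i : ℕ) + 3
  | _, _ => False

/-- The bipartite graph on `a₁, …, aₖ` (left) and `b₁, …, bₜ` (right) in which
`a₁, …, aₖ₋₃` have neighbourhood `{b₁, b₂, b₃}` and `aₖ₋₂, aₖ₋₁, aₖ` are adjacent to all `bⱼ`. -/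
def chainExample (k t : ℕ) : SimpleGraph (Fin k ⊕ Fin t) where
  Adj := chainAdj k t
  symm := ⟨by rintro (i | i) (j | j) h <;> exact h⟩
  loopless := ⟨by rintro (i | i) h <;> exact h⟩

instance (k t : ℕ) : DecidableRel (chainExample k t).Adj
  | .inl i, .inr j => inferInstanceAs (Decidable ((j : ℕ) < 3 ∨ k ≤ (i : ℕ) + 3))
  | .inr j, .inl i => inferInstanceAs (Decidable ((j : ℕ) < 3 ∨ k ≤ (i : ℕ) + 3))
  | .inl _, .inl _ => inferInstanceAs (Decidable False)
  | .inr _, .inr _ => inferInstanceAs (Decidable False)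

/-- The windmill: `t` copies of `K₄` sharing exactly one common vertex (`none`). -/
def windmill (t : ℕ) : SimpleGraph (Option (Fin t × Fin 3)) where
  Adj u v := u ≠ v ∧ (u = none ∨ v = none ∨ u.map Prod.fst = v.map Prod.fst)
  symm := ⟨fun _ _ h => ⟨h.1.symm, by
    rcases h.2 with h | h | h
    · exact Or.inr (Or.inl h)
    · exact Or.inl h
    · exact Or.inr (Or.inr h.symm)⟩⟩
  loopless := ⟨fun _ h => h.1 rfl⟩

instance (t : ℕ) : DecidableRel (windmill t).Adj := fun u v =>
  inferInstanceAs (Decidable (u ≠ v ∧ (u = none ∨ v = none ∨ u.map Prod.fst = v.map Prod.fst)))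

end RainbowIndex

namespace RainbowIndex

open SimpleGraph

/-! ### Rainbow trees from connected rainbow subgraphs -/

/-! Upper bounds. Fix a core `D`, any three vertices of which lie in a connected subgraph that is
rainbow in a reserved palette. Three arbitrary vertices are walked to `D` within colour sets
disjoint from one another and from that palette (`exists_connected_of_joinedWithin`); a spanning
tree of the union is a rainbow tree. In a threshold graph the core is a path on three universal
vertices (2 colours), in a chain graph a `K_{3,3}` coloured as a Latin square (3 colours). The i-th
vertex then enters the core by one edge of its private colour, which costs 3 more. In an interval
graph that is not complete, a dominating walk of length at most `diam - 2` is the core, and six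
further colours suffice outside it (`rainbowIndex_le_of_dominating_walk`).

These six are three leg colours `inl` for edges into `D` and three inner colours `inr`. Every
outside vertex gets three routes to `D` that fit into the blocks of a partition of the six colours,
and a finite check shows that any three vertices can choose disjoint blocks
(`exists_disjoint_optionColors`). Routes come from a depth-first search forest outside `D` coloured
by depth modulo 3: a vertex uses its own leg, its parent's leg or a child's leg. Leaves lack a child
and roots lack a parent; minimum degree 3 supplies a further leg or back edge instead, after
recolouring the exceptional edges at `IsTrick` and `IsSpecial` vertices.

Lower bounds. By pigeonhole, three of the many equal pieces of each example are coloured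
identically. A rainbow tree through corresponding vertices must use differently coloured edges in
each piece, which forces many vertices (`IsRainbowTree.mem_verts_of_twins`) or many colours
(`injOn_of_equal_blades`). -/

theorem exists_isTree_subgraph_le {V : Type*} {G : SimpleGraph V} {T : G.Subgraph}
    (hT : T.Connected) : ∃ T' ≤ T, T'.verts = T.verts ∧ T'.coe.IsTree := by
  obtain ⟨F, hF, hFt⟩ := hT.coe.exists_isTree_le
  let T' : G.Subgraph :=
    { verts := T.verts
      Adj := fun a b => ∃ (ha : a ∈ T.verts) (hb : b ∈ T.verts), F.Adj ⟨a, ha⟩ ⟨b, hb⟩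
      adj_sub := by
        rintro a b ⟨ha, hb, h⟩
        exact T.adj_sub (hF h)
      edge_vert := by
        rintro a b ⟨ha, hb, h⟩
        exact ha
      symm := ⟨by
        rintro a b ⟨ha, hb, h⟩
        exact ⟨hb, ha, h.symm⟩⟩ }
  have hcoe : T'.coe = F := by
    ext a b
    constructor
    · rintro ⟨ha, hb, h⟩
      exact h
    · intro h
      exact ⟨a.2, b.2, h⟩
  refine ⟨T', ⟨le_rfl, ?_⟩, rfl, ?_⟩
  · rintro a b ⟨ha, hb, h⟩
    exact hF h
  · rw [hcoe]
    exact hFt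

/-- A colouring of all pairs of vertices such that any three vertices lie in a connected rainbow
subgraph bounds the `3`-rainbow index. -/
theorem rainbowIndex_le_of_coloring {V C : Type*} [Fintype C] {G : SimpleGraph V} {t : ℕ}
    (hC : Fintype.card C ≤ t) (c : Sym2 V → C)
    (h : ∀ v : Fin 3 → V, ∃ T : G.Subgraph, T.Connected ∧ (∀ i, v i ∈ T.verts) ∧
      Set.InjOn c T.edgeSet) :
    rainbowIndex 3 G ≤ t := by
  classical
  obtain ⟨φ⟩ : Nonempty (C ↪ Fin t) :=
    Function.Embedding.nonempty_of_card_le (by simpa using hC)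
  refine iInf₂_le t ⟨fun e => φ (c e), ?_⟩
  intro S hS
  obtain ⟨x, y, z, -, -, -, rfl⟩ := Finset.card_eq_three.1 hS
  obtain ⟨T, hT, hv, hc⟩ := h ![x, y, z]
  obtain ⟨T', hle, hverts, htree⟩ := exists_isTree_subgraph_le hT
  refine ⟨T', htree, ?_, ?_⟩
  · intro a ha
    rw [hverts]
    simp only [Finset.coe_insert, Finset.coe_singleton, Set.mem_insert_iff,
      Set.mem_singleton_iff] at ha
    rcases ha with rfl | rfl | rfl
    · exact hv 0
    · exact hv 1
    · exact hv 2
  · intro e f he hf hef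
    have hsub := Subgraph.edgeSet_mono hle
    exact Subtype.ext (hc (hsub he) (hsub hf) (φ.injective hef))

/-- In the colouring `c`, the vertex `v` is joined to a vertex of `D` by a walk on which every
colour belongs to `K` and distinct edges have distinct colours. -/
def JoinedWithin {V C : Type*} (G : SimpleGraph V) (c : Sym2 V → C) (D : Set V) (v : V)
    (K : Finset C) : Prop :=
  ∃ d ∈ D, ∃ w : G.Walk v d, (∀ e ∈ w.edges, c e ∈ K) ∧ Set.InjOn c {e | e ∈ w.edges}

theorem JoinedWithin.of_mem {V C : Type*} {G : SimpleGraph V} {c : Sym2 V → C} {D : Set V} {v : V}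
    (hv : v ∈ D) (K : Finset C) : JoinedWithin G c D v K :=
  ⟨v, hv, Walk.nil, by simp, by simp [Set.InjOn]⟩

theorem JoinedWithin.mono {V C : Type*} {G : SimpleGraph V} {c : Sym2 V → C} {D : Set V} {v : V}
    {K K' : Finset C} (h : JoinedWithin G c D v K) (hK : K ⊆ K') : JoinedWithin G c D v K' := by
  obtain ⟨d, hd, w, hw, hi⟩ := h
  exact ⟨d, hd, w, fun e he => hK (hw e he), hi⟩

theorem JoinedWithin.cons {V C : Type*} [DecidableEq C] {G : SimpleGraph V} {c : Sym2 V → C}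
    {D : Set V} {u v : V} {K : Finset C} (h : JoinedWithin G c D v K) (huv : G.Adj u v)
    (hc : c s(u, v) ∉ K) : JoinedWithin G c D u (insert (c s(u, v)) K) := by
  obtain ⟨d, hd, w, hw, hi⟩ := h
  refine ⟨d, hd, Walk.cons huv w, ?_, ?_⟩
  · intro e he
    rw [Walk.edges_cons, List.mem_cons] at he
    rcases he with rfl | he
    · exact Finset.mem_insert_self _ _
    · exact Finset.mem_insert_of_mem (hw e he)
  · intro e he f hf hef
    simp only [Walk.edges_cons, List.mem_cons, Set.mem_ofPred_eq] at he hf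
    rcases he with rfl | he <;> rcases hf with rfl | hf
    · rfl
    · exact absurd (hef ▸ hw f hf) hc
    · exact absurd (hef ▸ hw e he) hc
    · exact hi he hf hef

theorem JoinedWithin.of_adj {V C : Type*} [DecidableEq C] {G : SimpleGraph V} {c : Sym2 V → C}
    {D : Set V} {u v : V} (hv : v ∈ D) (huv : G.Adj u v) :
    JoinedWithin G c D u {c s(u, v)} :=
  (JoinedWithin.of_mem hv ∅).cons huv (Finset.notMem_empty _)

/-- Disjointness of `K` and `K'` rules out colour clashes between `T` and the walk. The new palette
`K ∪ K'` is recorded so that the step can be iterated. -/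
theorem exists_connected_sup_walk {V C : Type*} [DecidableEq C] {G : SimpleGraph V}
    {c : Sym2 V → C} {T : G.Subgraph} (hT : T.Connected) (hi : Set.InjOn c T.edgeSet)
    {K K' : Finset C} (hK : ∀ e ∈ T.edgeSet, c e ∈ K) {v f : V} (hf : f ∈ T.verts)
    (w : G.Walk v f) (hw : ∀ e ∈ w.edges, c e ∈ K') (hwi : Set.InjOn c {e | e ∈ w.edges})
    (hd : Disjoint K K') :
    ∃ T' : G.Subgraph, T ≤ T' ∧ T'.Connected ∧ Set.InjOn c T'.edgeSet ∧
      (∀ e ∈ T'.edgeSet, c e ∈ K ∪ K') ∧ v ∈ T'.verts := by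
  refine ⟨T ⊔ w.toSubgraph, le_sup_left, ?_, ?_, ?_, ?_⟩
  · exact Subgraph.connected_sup hT.preconnected w.toSubgraph_connected.preconnected
      ⟨f, hf, w.end_mem_verts_toSubgraph⟩
  · rw [Subgraph.edgeSet_sup]
    rintro e (he | he) g (hg | hg) h
    · exact hi he hg h
    · rw [Walk.mem_edges_toSubgraph] at hg
      exact absurd (h ▸ hw g hg) (Finset.disjoint_left.1 hd (hK e he))
    · rw [Walk.mem_edges_toSubgraph] at he
      exact absurd (h ▸ hw e he) (Finset.disjoint_left.1 hd (hK g hg))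
    · rw [Walk.mem_edges_toSubgraph] at he hg
      exact hwi he hg h
  · rw [Subgraph.edgeSet_sup]
    rintro e (he | he)
    · exact Finset.mem_union_left _ (hK e he)
    · rw [Walk.mem_edges_toSubgraph] at he
      exact Finset.mem_union_right _ (hw e he)
  · exact Or.inr w.start_mem_verts_toSubgraph

/-- Three vertices joined to a rainbow core within disjoint sets of colours, which avoid the
colours of the core, lie in a connected rainbow subgraph. -/
theorem exists_connected_of_joinedWithin {V C : Type*} [DecidableEq C] {G : SimpleGraph V}
    {c : Sym2 V → C} {D : Set V} {K₀ : Finset C}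
    (hcore : ∀ f : Fin 3 → V, (∀ i, f i ∈ D) → ∃ T : G.Subgraph, T.Connected ∧
      (∀ i, f i ∈ T.verts) ∧ Set.InjOn c T.edgeSet ∧ ∀ e ∈ T.edgeSet, c e ∈ K₀)
    (v : Fin 3 → V) (K : Fin 3 → Finset C) (hK₀ : ∀ i, Disjoint K₀ (K i))
    (hK : Pairwise fun i j => Disjoint (K i) (K j)) (hv : ∀ i, JoinedWithin G c D (v i) (K i)) :
    ∃ T : G.Subgraph, T.Connected ∧ (∀ i, v i ∈ T.verts) ∧ Set.InjOn c T.edgeSet := by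
  choose f hf w hw hwi using hv
  obtain ⟨T, hT, hfT, hi, hTK⟩ := hcore f hf
  obtain ⟨T₁, hle₁, hT₁, hi₁, hK₁, hv₁⟩ :=
    exists_connected_sup_walk hT hi hTK (hfT 0) (w 0) (hw 0) (hwi 0) (hK₀ 0)
  obtain ⟨T₂, hle₂, hT₂, hi₂, hK₂, hv₂⟩ :=
    exists_connected_sup_walk hT₁ hi₁ hK₁ (hle₁.1 (hfT 1)) (w 1) (hw 1) (hwi 1)
      (Finset.disjoint_union_left.2 ⟨hK₀ 1, hK (by decide)⟩)
  obtain ⟨T₃, hle₃, hT₃, hi₃, -, hv₃⟩ :=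
    exists_connected_sup_walk hT₂ hi₂ hK₂ (hle₂.1 (hle₁.1 (hfT 2))) (w 2) (hw 2) (hwi 2)
      (Finset.disjoint_union_left.2
        ⟨Finset.disjoint_union_left.2 ⟨hK₀ 2, hK (by decide)⟩, hK (by decide)⟩)
  refine ⟨T₃, hT₃, fun i => ?_, hi₃⟩
  fin_cases i
  · exact hle₃.1 (hle₂.1 hv₁)
  · exact hle₃.1 hv₂
  · exact hv₃

/-! ### Counting in rainbow trees -/

/-- Connectivity bounds the vertices by the edges plus one, and on a rainbow tree the colour map is
injective on edges. -/
theorem IsRainbowTree.ncard_verts_le {V : Type*} [Finite V] {G : SimpleGraph V} {t : ℕ}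
    {c : G.edgeSet → Fin t} {S : Finset V} {T : G.Subgraph} (h : IsRainbowTree c S T)
    (K : Finset (Fin t)) (hK : ∀ e : G.edgeSet, (e : Sym2 V) ∈ T.edgeSet → c e ∈ K) :
    T.verts.ncard ≤ K.card + 1 := by
  have h1 := h.isTree.connected.card_vert_le_card_edgeSet_add_one
  rw [Nat.card_coe_set_eq] at h1
  refine h1.trans (Nat.add_le_add_right ?_ 1)
  let g : T.coe.edgeSet → G.edgeSet := fun e =>
    ⟨Sym2.map (↑) e.1, by
      obtain ⟨e, he⟩ := e
      induction e with
      | _ a b => exact T.adj_sub he⟩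
  have hgT : ∀ e, (g e : Sym2 V) ∈ T.edgeSet := by
    rintro ⟨e, he⟩
    induction e with
    | _ a b => exact he
  have hg : Function.Injective g := by
    intro e f hef
    exact Subtype.ext (Sym2.map.injective Subtype.val_injective (congrArg Subtype.val hef))
  let φ : T.coe.edgeSet → K := fun e => ⟨c (g e), hK _ (hgT e)⟩
  have hφ : Function.Injective φ := by
    intro e f hef
    exact hg (h.isRainbow _ _ (hgT e) (hgT f) (congrArg Subtype.val hef))
  have := Nat.card_le_card_of_injective φ hφ
  simpa using this

theorem IsRainbowTree.ncard_verts_le' {V : Type*} [Finite V] {G : SimpleGraph V} {t : ℕ}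
    {c : G.edgeSet → Fin t} {S : Finset V} {T : G.Subgraph} (h : IsRainbowTree c S T) :
    T.verts.ncard ≤ t + 1 := by
  simpa using h.ncard_verts_le Finset.univ fun _ _ => Finset.mem_univ _

theorem exists_adj_of_connected {V : Type*} {G : SimpleGraph V} {T : G.Subgraph}
    (hT : T.coe.Connected) {A : Set V} {a b : V} (ha : a ∈ T.verts) (haA : a ∈ A)
    (hb : b ∈ T.verts) (hbA : b ∉ A) : ∃ x ∈ A, ∃ y, y ∉ A ∧ T.Adj x y := by
  obtain ⟨p⟩ := hT.preconnected ⟨a, ha⟩ ⟨b, hb⟩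
  obtain ⟨d, -, h1, h2⟩ := p.exists_boundary_dart (Subtype.val ⁻¹' A) haA hbA
  exact ⟨d.fst, h1, d.snd, h2, d.adj⟩

/-- The path inside the tree has fewer edges than the tree has vertices, and these number at most `t
+ 1`. -/
theorem IsRainbowTree.dist_le {V : Type*} [Finite V] {G : SimpleGraph V} {t : ℕ}
    {c : G.edgeSet → Fin t} {S : Finset V} {T : G.Subgraph} (h : IsRainbowTree c S T) {u v : V}
    (hu : u ∈ S) (hv : v ∈ S) : G.dist u v ≤ t := by
  classical
  obtain ⟨p, hp⟩ := h.isTree.connected.exists_isPath ⟨u, h.subset_verts hu⟩ ⟨v, h.subset_verts hv⟩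
  have := Fintype.ofFinite T.verts
  have h1 := hp.length_lt
  have h2 : G.dist u v ≤ p.length := by
    have := SimpleGraph.dist_le (p.map T.hom)
    rwa [Walk.length_map] at this
  have h3 := h.ncard_verts_le'
  rw [← Nat.card_coe_set_eq, Nat.card_eq_fintype_card] at h3
  omega

theorem le_rainbowIndex {V : Type*} {G : SimpleGraph V} {k n : ℕ}
    (h : ∀ (t : ℕ) (c : G.edgeSet → Fin t), IsRainbowColoring k c → n ≤ t) :
    (n : ℕ∞) ≤ rainbowIndex k G :=
  le_iInf₂ fun t ⟨c, hc⟩ => Nat.cast_le.2 (h t c hc)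

theorem diam_le_rainbowIndex {V : Type*} [Fintype V] {G : SimpleGraph V}
    (hV : 3 ≤ Fintype.card V) : (G.diam : ℕ∞) ≤ rainbowIndex 3 G := by
  classical
  refine le_rainbowIndex fun t c hc => ?_
  have : Nonempty V := Fintype.card_pos_iff.1 (by omega)
  obtain ⟨u, v, huv⟩ := G.exists_dist_eq_diam
  obtain ⟨S, hS, hcard⟩ := Finset.exists_superset_card_eq (s := {u, v}) (n := 3)
    (Finset.card_le_two.trans (by norm_num)) hV
  obtain ⟨T, hT⟩ := hc S hcard
  rw [← huv]
  exact hT.dist_le (hS (by simp)) (hS (by simp))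

/-! ### Stars -/

theorem exists_rainbow_star {V C ι : Type*} {G : SimpleGraph V} (c : Sym2 V → C) {z : V}
    {l : ι → V} (hl : ∀ i, G.Adj z (l i)) (hc : Function.Injective fun i => c s(z, l i)) :
    ∃ T : G.Subgraph, T.Connected ∧ z ∈ T.verts ∧ (∀ i, l i ∈ T.verts) ∧
      Set.InjOn c T.edgeSet ∧ ∀ e ∈ T.edgeSet, ∃ i, e = s(z, l i) := by
  let T : G.Subgraph :=
    { verts := insert z (Set.range l)
      Adj := fun u v => ∃ i, s(u, v) = s(z, l i)
      adj_sub := by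
        rintro u v ⟨i, hi⟩
        rw [← mem_edgeSet, hi]
        exact hl i
      edge_vert := by
        rintro u v ⟨i, hi⟩
        rcases Sym2.eq_iff.1 hi with ⟨rfl, rfl⟩ | ⟨rfl, rfl⟩
        · exact Set.mem_insert _ _
        · exact Set.mem_insert_of_mem _ ⟨i, rfl⟩
      symm := ⟨by
        rintro u v ⟨i, hi⟩
        exact ⟨i, Sym2.eq_swap.trans hi⟩⟩ }
  have hT : ∀ e ∈ T.edgeSet, ∃ i, e = s(z, l i) := by
    intro e he
    induction e with
    | _ u v => exact he
  refine ⟨T, ?_, Set.mem_insert _ _, fun i => Set.mem_insert_of_mem _ ⟨i, rfl⟩, ?_, hT⟩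
  · rw [Subgraph.connected_iff', connected_iff_exists_forall_reachable]
    refine ⟨⟨z, Set.mem_insert _ _⟩, ?_⟩
    rintro ⟨v, rfl | ⟨i, rfl⟩⟩
    · exact Reachable.refl _
    · refine Adj.reachable ?_
      exact ⟨i, rfl⟩
  · intro e he f hf hef
    obtain ⟨i, rfl⟩ := hT e he
    obtain ⟨j, rfl⟩ := hT f hf
    rw [hc hef]

/-! ### Threshold graphs -/

/-- A vertex of degree at least three has a neighbour distinct from any two given vertices. -/
theorem exists_adj_ne_ne {V : Type*} [Fintype V] {G : SimpleGraph V} [DecidableRel G.Adj]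
    (hδ : 3 ≤ G.minDegree) (x a b : V) : ∃ y, G.Adj x y ∧ y ≠ a ∧ y ≠ b := by
  classical
  have h1 : 3 ≤ (G.neighborFinset x).card := hδ.trans (G.minDegree_le_degree x)
  obtain ⟨y, hy, hy'⟩ := Finset.exists_mem_notMem_of_card_lt_card
    (s := {a, b}) (t := G.neighborFinset x) (lt_of_le_of_lt Finset.card_le_two (by omega))
  rw [mem_neighborFinset] at hy
  simp only [Finset.mem_insert, Finset.mem_singleton, not_or] at hy'
  exact ⟨y, hy, hy'⟩

/-- Take `u` of maximal weight outside `{a, b}`: every `x` has a neighbour outside `{a, b}`, and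
replacing it by `u` only increases the weight sum. -/
theorem IsThresholdGraph.exists_universal {V : Type*} [Finite V] [Nonempty V] {G : SimpleGraph V}
    (hG : IsThresholdGraph G) (hδ : ∀ x a b : V, ∃ y, G.Adj x y ∧ y ≠ a ∧ y ≠ b) (a b : V) :
    ∃ u, u ≠ a ∧ u ≠ b ∧ ∀ x, x ≠ u → G.Adj x u := by
  obtain ⟨w, τ, h⟩ := hG
  obtain ⟨z, -, hz⟩ := hδ a a b
  obtain ⟨u, hu, hmax⟩ :=
    Set.exists_max_image {u | u ≠ a ∧ u ≠ b} w (Set.toFinite _) ⟨z, hz⟩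
  refine ⟨u, hu.1, hu.2, fun x hx => ?_⟩
  obtain ⟨y, hxy, hy⟩ := hδ x a b
  have h1 := (h x y hxy.ne).1 hxy
  have h2 := hmax y hy
  exact (h x u hx).2 (by linarith)

theorem IsThresholdGraph.rainbowIndex_le {V : Type*} [Finite V] [Nonempty V] {G : SimpleGraph V}
    (hG : IsThresholdGraph G) (hδ : ∀ x a b : V, ∃ y, G.Adj x y ∧ y ≠ a ∧ y ≠ b) :
    rainbowIndex 3 G ≤ 5 := by
  classical
  obtain ⟨y₀, -, -, h₀⟩ := hG.exists_universal hδ (Classical.arbitrary V) (Classical.arbitrary V)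
  obtain ⟨y₁, h10, -, h₁⟩ := hG.exists_universal hδ y₀ y₀
  obtain ⟨y₂, h20, h21, h₂⟩ := hG.exists_universal hδ y₀ y₁
  let y : Fin 3 → V := ![y₀, y₁, y₂]
  have hy : ∀ i x, x ≠ y i → G.Adj x (y i) := by
    intro i
    fin_cases i
    · exact h₀
    · exact h₁
    · exact h₂
  -- The path `y₀ y₁ y₂` has two colours of its own; an edge from outside the path to `yᵢ` has
  -- colour `inr i`.
  let c : Sym2 V → Bool ⊕ Fin 3 := fun e =>
    if e = s(y₁, y₀) then .inl true else if e = s(y₁, y₂) then .inl false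
    else if y₀ ∈ e then .inr 0 else if y₁ ∈ e then .inr 1 else .inr 2
  refine rainbowIndex_le_of_coloring (t := 5) (C := Bool ⊕ Fin 3) (by simp) c fun v => ?_
  have hcore : ∀ f : Fin 3 → V, (∀ i, f i ∈ Set.range y) → ∃ T : G.Subgraph, T.Connected ∧
      (∀ i, f i ∈ T.verts) ∧ Set.InjOn c T.edgeSet ∧
      ∀ e ∈ T.edgeSet, c e ∈ ({.inl true, .inl false} : Finset (Bool ⊕ Fin 3)) := by
    intro f hf
    have hne : s(y₁, y₂) ≠ s(y₁, y₀) := by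
      simp [h10, h20]
    obtain ⟨T, hT, hz, hl, hi, he⟩ := exists_rainbow_star (G := G) c (z := y₁)
      (l := ![y₀, y₂]) (by
        intro i
        fin_cases i
        · exact h₀ _ h10
        · exact h₂ _ h21.symm) (by
        intro i j hij
        fin_cases i <;> fin_cases j <;> simp [c, hne] at hij ⊢)
    refine ⟨T, hT, ?_, hi, ?_⟩
    · intro i
      obtain ⟨j, hj⟩ := hf i
      rw [← hj]
      fin_cases j
      · exact hl 0
      · exact hz
      · exact hl 1
    · intro e heT
      obtain ⟨i, rfl⟩ := he e heT
      fin_cases i <;> simp [c, hne]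
  refine exists_connected_of_joinedWithin hcore v (fun i => {.inr i}) (by simp) ?_ ?_
  · intro i j hij
    simpa using hij
  · intro i
    generalize v i = x
    by_cases hx : x ∈ Set.range y
    · exact .of_mem hx _
    · have hne : ∀ j, y j ≠ x := fun j hj => hx ⟨j, hj⟩
      have e₀ : y₀ ≠ x := hne 0
      have e₁ : y₁ ≠ x := hne 1
      have e₂ : y₂ ≠ x := hne 2
      have := JoinedWithin.of_adj (c := c) (Set.mem_range_self i) (hy i x (hne i).symm)
      convert this using 2
      fin_cases i <;>
        simp [c, y, e₀, e₁, e₀.symm, e₁.symm, e₂.symm, h10, h10.symm, h20.symm, h21.symm]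

/-! ### Chain graphs -/

/-- The colouring `i + j` makes every star of the `K_{3,3}` rainbow. One of the two sides contains
at most one of the three vertices, so a star centred on that side covers them all. -/
theorem exists_rainbow_of_complete_bipartite {V C : Type*} {G : SimpleGraph V} (c : Sym2 V → C)
    {a b : Fin 3 → V} (hab : ∀ i j, G.Adj (a i) (b j)) {g : Fin 3 → C}
    (hg : Function.Injective g) (hc : ∀ i j, c s(a i, b j) = g (i + j)) (f : Fin 3 → V)
    (hf : ∀ i, f i ∈ Set.range a ∪ Set.range b) :
    ∃ T : G.Subgraph, T.Connected ∧ (∀ i, f i ∈ T.verts) ∧ Set.InjOn c T.edgeSet ∧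
      ∀ e ∈ T.edgeSet, c e ∈ Set.range g := by
  have hb : ∀ j, (∀ i, f i ∈ Set.range a ∨ f i = b j) → ∃ T : G.Subgraph, T.Connected ∧
      (∀ i, f i ∈ T.verts) ∧ Set.InjOn c T.edgeSet ∧ ∀ e ∈ T.edgeSet, c e ∈ Set.range g := by
    intro j hj
    obtain ⟨T, hT, hz, hl, hi, he⟩ := exists_rainbow_star (G := G) c (z := b j) (l := a)
      (fun i => (hab i j).symm) (by
        intro i i' h
        simp only [Sym2.eq_swap (a := b j), hc] at h
        exact add_right_cancel (hg h))
    refine ⟨T, hT, fun i => ?_, hi, fun e heT => ?_⟩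
    · rcases hj i with ⟨i', h⟩ | h
      · exact h ▸ hl i'
      · exact h ▸ hz
    · obtain ⟨i, rfl⟩ := he e heT
      rw [Sym2.eq_swap, hc]
      exact ⟨_, rfl⟩
  have ha : ∀ i, (∀ j, f j ∈ Set.range b ∨ f j = a i) → ∃ T : G.Subgraph, T.Connected ∧
      (∀ i, f i ∈ T.verts) ∧ Set.InjOn c T.edgeSet ∧ ∀ e ∈ T.edgeSet, c e ∈ Set.range g := by
    intro i hj
    obtain ⟨T, hT, hz, hl, hi, he⟩ := exists_rainbow_star (G := G) c (z := a i) (l := b)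
      (fun j => hab i j) (by
        intro i i' h
        simp only [hc] at h
        exact add_left_cancel (hg h))
    refine ⟨T, hT, fun k => ?_, hi, fun e heT => ?_⟩
    · rcases hj k with ⟨i', h⟩ | h
      · exact h ▸ hl i'
      · exact h ▸ hz
    · obtain ⟨i, rfl⟩ := he e heT
      rw [hc]
      exact ⟨_, rfl⟩
  rcases hf 0 with h0 | ⟨j0, h0⟩ <;> rcases hf 1 with h1 | ⟨j1, h1⟩ <;>
    rcases hf 2 with h2 | ⟨j2, h2⟩
  · exact hb 0 (by rw [Fin.forall_fin_succ, Fin.forall_fin_two]; exact ⟨.inl h0, .inl h1, .inl h2⟩)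
  · exact hb j2 (by
      rw [Fin.forall_fin_succ, Fin.forall_fin_two]; exact ⟨.inl h0, .inl h1, .inr h2.symm⟩)
  · exact hb j1 (by
      rw [Fin.forall_fin_succ, Fin.forall_fin_two]; exact ⟨.inl h0, .inr h1.symm, .inl h2⟩)
  · obtain ⟨i, h⟩ := h0
    exact ha i (by
      rw [Fin.forall_fin_succ, Fin.forall_fin_two]; exact ⟨.inr h.symm, .inl ⟨_, h1⟩, .inl ⟨_, h2⟩⟩)
  · exact hb j0 (by
      rw [Fin.forall_fin_succ, Fin.forall_fin_two]; exact ⟨.inr h0.symm, .inl h1, .inl h2⟩)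
  · obtain ⟨i, h⟩ := h1
    exact ha i (by
      rw [Fin.forall_fin_succ, Fin.forall_fin_two]; exact ⟨.inl ⟨_, h0⟩, .inr h.symm, .inl ⟨_, h2⟩⟩)
  · obtain ⟨i, h⟩ := h2
    exact ha i (by
      rw [Fin.forall_fin_succ, Fin.forall_fin_two]; exact ⟨.inl ⟨_, h0⟩, .inl ⟨_, h1⟩, .inr h.symm⟩)
  · exact ha 0 (by
      rw [Fin.forall_fin_succ, Fin.forall_fin_two]
      exact ⟨.inl ⟨_, h0⟩, .inl ⟨_, h1⟩, .inl ⟨_, h2⟩⟩)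

theorem exists_injective_fin_three {V : Type*} [Nonempty V] {P : V → Prop}
    (h : ∀ a b, ∃ u, u ≠ a ∧ u ≠ b ∧ P u) : ∃ y : Fin 3 → V, Function.Injective y ∧ ∀ i, P (y i) := by
  obtain ⟨y₀, -, -, h₀⟩ := h (Classical.arbitrary V) (Classical.arbitrary V)
  obtain ⟨y₁, h10, -, h₁⟩ := h y₀ y₀
  obtain ⟨y₂, h20, h21, h₂⟩ := h y₀ y₁
  refine ⟨![y₀, y₁, y₂], ?_, ?_⟩
  · intro i j hij
    fin_cases i <;> fin_cases j <;> simp_all [eq_comm]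
  · intro i
    fin_cases i
    · exact h₀
    · exact h₁
    · exact h₂

theorem rainbowIndex_le_of_bipartite_core {V : Type*} {G : SimpleGraph V} {A B : Set V}
    (hAB : Disjoint A B) (hun : A ∪ B = Set.univ) {a b : Fin 3 → V}
    (hai : Function.Injective a) (hbi : Function.Injective b)
    (ha : ∀ i, a i ∈ A ∧ ∀ v ∈ B, G.Adj (a i) v) (hb : ∀ i, b i ∈ B ∧ ∀ v ∈ A, G.Adj (b i) v) :
    rainbowIndex 3 G ≤ 6 := by
  classical
  have hne : ∀ i j, a i ≠ b j := fun i j h =>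
    Set.disjoint_left.1 hAB (ha i).1 (h ▸ (hb j).1)
  let c : Sym2 V → Fin 3 ⊕ Fin 3 := fun e =>
    if h : ∃ k : Fin 3 × Fin 3, e = s(a k.1, b k.2) then .inl (h.choose.1 + h.choose.2)
    -- For an edge with exactly one end in the core the index `k` is unique (`hc₂`); edges missing
    -- the core get an arbitrary colour.
    else if h' : ∃ k : Fin 3, a k ∈ e ∨ b k ∈ e then .inr h'.choose else .inr 0
  have hc₁ : ∀ i j, c s(a i, b j) = .inl (i + j) := by
    intro i j
    have h : ∃ k : Fin 3 × Fin 3, s(a i, b j) = s(a k.1, b k.2) := ⟨(i, j), rfl⟩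
    simp only [c, dif_pos h]
    rcases Sym2.eq_iff.1 h.choose_spec with ⟨h1, h2⟩ | ⟨h1, h2⟩
    · rw [← hai h1, ← hbi h2]
    · exact absurd h1 (hne _ _)
  have hc₂ : ∀ x, x ∉ Set.range a ∪ Set.range b → ∀ k y, y = a k ∨ y = b k →
      c s(x, y) = .inr k := by
    intro x hx k y hy
    have h : ¬ ∃ k : Fin 3 × Fin 3, s(x, y) = s(a k.1, b k.2) := by
      rintro ⟨k, hk⟩
      rcases Sym2.eq_iff.1 hk with ⟨rfl, -⟩ | ⟨rfl, -⟩
      · exact hx (.inl ⟨_, rfl⟩)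
      · exact hx (.inr ⟨_, rfl⟩)
    have h' : ∃ k : Fin 3, a k ∈ s(x, y) ∨ b k ∈ s(x, y) :=
      ⟨k, by rcases hy with rfl | rfl <;> simp⟩
    simp only [c, dif_neg h, dif_pos h']
    congr 1
    rcases h'.choose_spec with h1 | h1 <;> rcases Sym2.mem_iff.1 h1 with h2 | h2
    · exact absurd (.inl ⟨_, h2⟩) hx
    · rcases hy with hy | hy
      · exact hai (h2.trans hy)
      · exact absurd (h2.trans hy) (hne _ _)
    · exact absurd (.inr ⟨_, h2⟩) hx
    · rcases hy with hy | hy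
      · exact absurd (h2.trans hy).symm (hne _ _)
      · exact hbi (h2.trans hy)
  refine rainbowIndex_le_of_coloring (t := 6) (C := Fin 3 ⊕ Fin 3) (by simp) c fun v => ?_
  refine exists_connected_of_joinedWithin (D := Set.range a ∪ Set.range b)
    (K₀ := Finset.univ.image .inl) (fun f hf => ?_) v (fun i => {.inr i}) (by simp) ?_ ?_
  · obtain ⟨T, h1, h2, h3, h4⟩ := exists_rainbow_of_complete_bipartite (G := G) c
      (fun i j => (ha i).2 _ (hb j).1) (g := .inl) Sum.inl_injective hc₁ f hf
    refine ⟨T, h1, h2, h3, fun e he => ?_⟩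
    obtain ⟨k, hk⟩ := h4 e he
    rw [← hk]
    simp
  · intro i j hij
    simpa using hij
  · intro i
    by_cases hv : v i ∈ Set.range a ∪ Set.range b
    · exact .of_mem hv _
    · have hvu : v i ∈ A ∪ B := hun ▸ Set.mem_univ _
      rcases hvu with h | h
      · have := JoinedWithin.of_adj (c := c) (D := Set.range a ∪ Set.range b)
          (.inr (Set.mem_range_self i)) ((hb i).2 _ h).symm
        rwa [hc₂ _ hv i _ (.inr rfl)] at this
      · have := JoinedWithin.of_adj (c := c) (D := Set.range a ∪ Set.range b)
          (.inl (Set.mem_range_self i)) ((ha i).2 _ h).symm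
        rwa [hc₂ _ hv i _ (.inl rfl)] at this

theorem IsChainGraph.rainbowIndex_le {V : Type*} [Nonempty V] {G : SimpleGraph V}
    (hG : IsChainGraph G) (hδ : ∀ x a b : V, ∃ y, G.Adj x y ∧ y ≠ a ∧ y ≠ b) :
    rainbowIndex 3 G ≤ 6 := by
  obtain ⟨A, B, hbip, hun, k, a, -, hran, hmono⟩ := hG
  have hBA : ∀ x ∈ B, ∀ y, G.Adj x y → y ∈ A := by
    intro x hx y hxy
    rcases hbip.mem_of_adj hxy with h | h
    · exact absurd hx (Set.disjoint_left.1 hbip.disjoint h.1)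
    · exact h.2
  have hAB : ∀ x ∈ A, ∀ y, G.Adj x y → y ∈ B := by
    intro x hx y hxy
    rcases hbip.mem_of_adj hxy with h | h
    · exact h.2
    · exact absurd h.1 (Set.disjoint_left.1 hbip.disjoint hx)
  obtain ⟨x₀, y₀, hxy₀, hx₀, hy₀⟩ : ∃ x y, G.Adj x y ∧ x ∈ A ∧ y ∈ B := by
    obtain ⟨y, hy, -⟩ := hδ (Classical.arbitrary V) (Classical.arbitrary V) (Classical.arbitrary V)
    rcases hbip.mem_of_adj hy with h | h
    · exact ⟨_, _, hy, h.1, h.2⟩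
    · exact ⟨_, _, hy.symm, h.2, h.1⟩
  obtain ⟨α, hαi, hα⟩ := exists_injective_fin_three (P := fun u => u ∈ A ∧ ∀ v ∈ B, G.Adj u v) (by
    intro u₁ u₂
    -- The last `a i` outside `{u₁, u₂}` works: each `v ∈ B` has a neighbour outside `{u₁, u₂}`, and
    -- its neighbourhood lies in that of `a i`.
    obtain ⟨z, hz, hz'⟩ := hδ y₀ u₁ u₂
    obtain ⟨i₀, rfl⟩ : z ∈ Set.range a := hran ▸ hBA _ hy₀ _ hz
    obtain ⟨i, hi, hmax⟩ := Set.exists_max_image {i | a i ≠ u₁ ∧ a i ≠ u₂} id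
      (Set.toFinite _) ⟨i₀, hz'⟩
    refine ⟨a i, hi.1, hi.2, hran ▸ Set.mem_range_self i, fun v hv => ?_⟩
    obtain ⟨y, hvy, hy⟩ := hδ v u₁ u₂
    obtain ⟨j, rfl⟩ : y ∈ Set.range a := hran ▸ hBA _ hv _ hvy
    exact hmono (hmax j hy) hvy.symm)
  obtain ⟨β, hβi, hβ⟩ := exists_injective_fin_three (P := fun u => u ∈ B ∧ ∀ v ∈ A, G.Adj u v) (by
    intro u₁ u₂
    obtain ⟨i₀, -⟩ : x₀ ∈ Set.range a := hran ▸ hx₀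
    have hk : 0 < k := i₀.pos
    -- A neighbour of the first `a`, whose neighbourhood is smallest, is adjacent to all of `A`.
    obtain ⟨z, hz, hz'⟩ := hδ (a ⟨0, hk⟩) u₁ u₂
    refine ⟨z, hz'.1, hz'.2, hAB _ (hran ▸ Set.mem_range_self _) _ hz, fun v hv => ?_⟩
    obtain ⟨i, rfl⟩ : v ∈ Set.range a := hran ▸ hv
    exact (hmono (show (⟨0, hk⟩ : Fin k) ≤ i from Nat.zero_le _) hz).symm)
  exact rainbowIndex_le_of_bipartite_core hbip.disjoint hun hαi hβi hα hβ

/-! ### Depth-first search forests -/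

/-- A spanning forest of `H` given by parents `par` and depths `d`, with roots in `R`. -/
structure IsRootedForest {V : Type*} (H : SimpleGraph V) (R : Set V) (par : V → V) (d : V → ℕ) :
    Prop where
  root : ∀ x, d x = 0 → x ∈ R ∧ par x = x
  step : ∀ x, d x ≠ 0 → H.Adj x (par x) ∧ d x = d (par x) + 1

namespace IsRootedForest

variable {V : Type*} {H : SimpleGraph V} {R : Set V} {par : V → V} {d : V → ℕ}

theorem depth_iterate (hF : IsRootedForest H R par d) (x : V) (k : ℕ) :
    d (par^[k] x) = d x - k := by
  induction k with
  | zero => simp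
  | succ k ih =>
    rw [Function.iterate_succ_apply']
    by_cases h : d (par^[k] x) = 0
    · rw [(hF.root _ h).2]
      omega
    · have := (hF.step _ h).2
      omega

theorem reachable_iterate (hF : IsRootedForest H R par d) (x : V) (k : ℕ) :
    H.Reachable x (par^[k] x) := by
  induction k with
  | zero => exact Reachable.refl _
  | succ k ih =>
    rw [Function.iterate_succ_apply']
    by_cases h : d (par^[k] x) = 0
    · rwa [(hF.root _ h).2]
    · exact ih.trans (hF.step _ h).1.reachable

theorem depth_lt_card [Fintype V] (hF : IsRootedForest H R par d) (x : V) :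
    d x < Fintype.card V := by
  classical
  have h : Finset.range (d x + 1) ⊆ Finset.univ.image d := by
    intro k hk
    rw [Finset.mem_range] at hk
    refine Finset.mem_image.2 ⟨par^[d x - k] x, Finset.mem_univ _, ?_⟩
    rw [hF.depth_iterate]
    omega
  have := (Finset.card_le_card h).trans Finset.card_image_le
  rwa [Finset.card_range, Finset.card_univ] at this

/-- Since `par` fixes roots, iterates may idle there; the least exponent counts the depth difference
exactly. -/
theorem exists_iterate_eq (hF : IsRootedForest H R par d) {x y : V} (h : ∃ k, par^[k] x = y) :
    ∃ k, par^[k] x = y ∧ d x = d y + k := by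
  classical
  refine ⟨Nat.find h, Nat.find_spec h, ?_⟩
  have h1 := hF.depth_iterate x (Nat.find h)
  rw [Nat.find_spec h] at h1
  suffices Nat.find h ≤ d x by omega
  by_contra! hlt
  refine Nat.find_min h hlt ?_
  have h0 : d (par^[d x] x) = 0 := by rw [hF.depth_iterate]; omega
  have h2 : ∀ j, par^[d x + j] x = par^[d x] x := by
    intro j
    induction j with
    | zero => rfl
    | succ j ih => rw [← add_assoc, Function.iterate_succ_apply', ih, (hF.root _ h0).2]
  rw [← h2 (Nat.find h - d x), Nat.add_sub_cancel' hlt.le]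
  exact Nat.find_spec h

-- Hanging the subtree of `x` below `y` deepens all of it by `d y + 1 - d x > 0`. As `y` is outside
-- that subtree, no cycle arises.
open Classical in
theorem reattach (hF : IsRootedForest H R par d) {x y : V} (hxy : H.Adj x y) (hx : d x ≠ 0)
    (hle : d x ≤ d y) (hy : ¬ ∃ k, par^[k] y = x) :
    IsRootedForest H R (Function.update par x y)
      (fun z => if ∃ k, par^[k] z = x then d z + (d y + 1 - d x) else d z) := by
  constructor
  · intro z hz
    have hz0 : d z = 0 := by
      split_ifs at hz <;> omega
    have hzx : z ≠ x := by
      rintro rfl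
      exact hx hz0
    rw [Function.update_of_ne hzx]
    exact hF.root z hz0
  · intro z hz
    by_cases hzx : z = x
    · subst hzx
      rw [Function.update_self, if_neg hy, if_pos ⟨0, rfl⟩]
      exact ⟨hxy, by omega⟩
    rw [Function.update_of_ne hzx]
    by_cases hd : ∃ k, par^[k] z = x
    · obtain ⟨k, hk⟩ := hd
      have hz0 : d z ≠ 0 := by
        intro h0
        apply hzx
        rw [← hk]
        exact (Function.iterate_fixed (hF.root z h0).2 k).symm
      have hp : ∃ k, par^[k] (par z) = x := by
        cases k with
        | zero => exact absurd hk hzx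
        | succ k => exact ⟨k, hk⟩
      rw [if_pos ⟨k, hk⟩, if_pos hp]
      have := hF.step z hz0
      exact ⟨this.1, by omega⟩
    · have hp : ¬ ∃ k, par^[k] (par z) = x := fun ⟨k, hk⟩ => hd ⟨k + 1, hk⟩
      rw [if_neg hd] at hz
      rw [if_neg hd, if_neg hp]
      exact hF.step z hz

end IsRootedForest

/-- A breadth-first forest, needed only to start the maximisation below. -/
theorem exists_isRootedForest {V : Type*} {H : SimpleGraph V} {rep : V → V}
    (hrep : ∀ x, H.Reachable (rep x) x) (hadj : ∀ x y, H.Adj x y → rep x = rep y) :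
    ∃ par d, IsRootedForest H (Set.range rep) par d := by
  have key : ∀ x, ∃ p, (H.dist (rep x) x = 0 → p = x) ∧ (H.dist (rep x) x ≠ 0 →
      H.Adj x p ∧ H.dist (rep x) x = H.dist (rep p) p + 1) := by
    intro x
    by_cases h0 : H.dist (rep x) x = 0
    · exact ⟨x, fun _ => rfl, fun h => absurd h0 h⟩
    obtain ⟨w, hw⟩ := (hrep x).symm.exists_walk_length_eq_dist
    rw [dist_comm] at hw
    obtain ⟨p, h, q, hq⟩ : ∃ p, H.Adj x p ∧ ∃ q : H.Walk p (rep x), w.length = q.length + 1 := by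
      rw [← hw] at h0
      clear hw
      revert w
      generalize rep x = r
      intro w h0
      cases w with
      | nil => exact absurd rfl h0
      | @cons _ p _ h q => exact ⟨p, h, q, rfl⟩
    · refine ⟨p, fun h => absurd h h0, fun _ => ⟨h, ?_⟩⟩
      have hrp := hadj _ _ h
      have h1 : H.dist (rep x) p ≤ q.length := by
        rw [dist_comm]
        exact dist_le q
      have hr : H.Reachable (rep x) p := by
        rw [hrp]
        exact hrep p
      obtain ⟨w', hw'⟩ := hr.exists_walk_length_eq_dist
      have h2 := dist_le (w'.concat h.symm)
      rw [Walk.length_concat] at h2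
      rw [← hrp]
      omega
  choose par hp0 hp1 using key
  refine ⟨par, fun x => H.dist (rep x) x, fun x hx => ⟨⟨x, ?_⟩, hp0 x hx⟩, hp1⟩
  exact (hrep x).dist_eq_zero_iff.1 hx

/-- A forest maximising the sum of depths is a depth-first search forest: an edge between
incomparable vertices would allow `reattach`, which increases the sum. -/
theorem exists_isRootedForest_comparable {V : Type*} [Finite V] {H : SimpleGraph V} {rep : V → V}
    (hrep : ∀ x, H.Reachable (rep x) x) (hadj : ∀ x y, H.Reachable x y → rep x = rep y) :
    ∃ par d, IsRootedForest H (Set.range rep) par d ∧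
      ∀ x y, H.Adj x y → (∃ k, par^[k] x = y) ∨ ∃ k, par^[k] y = x := by
  classical
  have := Fintype.ofFinite V
  let N : Set ℕ := {n | ∃ par d, IsRootedForest H (Set.range rep) par d ∧ ∑ x, d x = n}
  have hne : N.Nonempty := by
    obtain ⟨par, d, hF⟩ := exists_isRootedForest hrep fun x y h => hadj x y h.reachable
    exact ⟨_, par, d, hF, rfl⟩
  have hbdd : BddAbove N := by
    refine ⟨∑ _x : V, Fintype.card V, ?_⟩
    rintro n ⟨par, d, hF, rfl⟩
    exact Finset.sum_le_sum fun x _ => (hF.depth_lt_card x).le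
  obtain ⟨par, d, hF, hsum⟩ := Nat.sSup_mem hne hbdd
  have key : ∀ x y, H.Adj x y → d x ≤ d y → ∃ k, par^[k] y = x := by
    intro x y hxy hle
    by_contra hy
    -- A root is the sole representative of its component, so climbing from `y` ends at `x`.
    by_cases hx : d x = 0
    · apply hy
      refine ⟨d y, ?_⟩
      obtain ⟨⟨x', hx'⟩, -⟩ := hF.root x hx
      obtain ⟨⟨y', hy'⟩, -⟩ := hF.root (par^[d y] y) (by rw [hF.depth_iterate]; omega)
      rw [← hx', ← hy']
      refine hadj _ _ ?_
      have h1 := hrep x'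
      have h2 := hrep y'
      rw [hx'] at h1
      rw [hy'] at h2
      exact h2.symm.trans ((hF.reachable_iterate y _).symm.trans (hxy.symm.reachable.trans h1))
    · have hF' := hF.reattach hxy hx hle hy
      have hle' := le_csSup hbdd ⟨_, _, hF', rfl⟩
      rw [← hsum] at hle'
      refine absurd hle' (not_le.2 (Finset.sum_lt_sum (fun z _ => ?_) ⟨x, Finset.mem_univ _, ?_⟩))
      · split_ifs <;> omega
      · rw [if_pos ⟨0, rfl⟩]
        omega
  refine ⟨par, d, hF, fun x y hxy => ?_⟩
  rcases le_total (d x) (d y) with h | h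
  · exact .inr (key x y hxy h)
  · exact .inl (key y x hxy.symm h)

/-- Every finite graph has a spanning forest in which adjacent vertices are comparable; in each
component the root can be chosen to have a given property if some vertex has it. -/
theorem exists_dfs_forest {V : Type*} [Finite V] (H : SimpleGraph V) (P : V → Prop) :
    ∃ (par : V → V) (d : V → ℕ),
      (∀ x, d x ≠ 0 → H.Adj x (par x) ∧ d x = d (par x) + 1) ∧
      (∀ x y, H.Adj x y → d x ≠ d y) ∧
      (∀ x y, H.Adj x y → d y < d x → y = par x ∨ d y + 2 ≤ d x ∧
        ∃ y', par y' = y ∧ d y' = d y + 1 ∧ ∃ y'', par y'' = y' ∧ d y'' = d y' + 1) ∧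
      (∀ x y, d x = 0 → H.Reachable x y → P y → P x) := by
  classical
  have hrep : ∀ C : H.ConnectedComponent, ∃ r, H.connectedComponentMk r = C ∧
      ∀ y, H.connectedComponentMk y = C → P y → P r := by
    intro C
    by_cases h : ∃ y, H.connectedComponentMk y = C ∧ P y
    · obtain ⟨y, hy, hP⟩ := h
      exact ⟨y, hy, fun _ _ _ => hP⟩
    · obtain ⟨y, hy⟩ := C.exists_rep
      exact ⟨y, hy, fun z hz hP => absurd ⟨z, hz, hP⟩ h⟩
  choose ρ hρ hρP using hrep
  obtain ⟨par, d, hF, hcomp⟩ := exists_isRootedForest_comparable (H := H)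
    (rep := fun x => ρ (H.connectedComponentMk x))
    (fun x => ConnectedComponent.exact (hρ _))
    (fun x y h => congrArg ρ (ConnectedComponent.sound h))
  have key : ∀ x y, H.Adj x y → d y ≤ d x → ∃ k, par^[k] x = y ∧ d x = d y + k ∧ k ≠ 0 := by
    intro x y hxy hle
    rcases hcomp x y hxy with h | h
    · obtain ⟨k, hk, hd⟩ := hF.exists_iterate_eq h
      refine ⟨k, hk, hd, ?_⟩
      rintro rfl
      exact hxy.ne hk
    · obtain ⟨k, hk, hd⟩ := hF.exists_iterate_eq h
      obtain rfl : k = 0 := by omega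
      exact absurd hk.symm hxy.ne
  refine ⟨par, d, hF.step, ?_, ?_, ?_⟩
  · intro x y hxy hd
    obtain ⟨k, -, hk, hk0⟩ := key x y hxy hd.ge
    omega
  · intro x y hxy hlt
    obtain ⟨k, hk, hd, hk0⟩ := key x y hxy hlt.le
    match k, hk0 with
    | 1, _ => exact .inl hk.symm
    | k + 2, _ =>
      refine .inr ⟨by omega, par^[k + 1] x, ?_, ?_, par^[k] x, ?_, ?_⟩
      · rw [← hk, Function.iterate_succ_apply' par (k + 1)]
      · rw [hF.depth_iterate]
        omega
      · rw [Function.iterate_succ_apply']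
      · rw [hF.depth_iterate, hF.depth_iterate]
        omega
  · intro x y hx hxy hy
    obtain ⟨⟨x', hx'⟩, -⟩ := hF.root x hx
    dsimp only at hx'
    rw [← hx']
    refine hρP _ y ?_ hy
    rw [← hρ (H.connectedComponentMk x'), hx']
    exact (ConnectedComponent.sound hxy).symm

/-! ### Colouring the edges outside a connected dominating set -/

/-- The three sets of colours available to a vertex of type `p` with short option `q`; the colours
`inl k` are used on edges to the dominating set, the colours `inr k` on the other edges. -/
def optionColors (p q : ZMod 3) : Fin 3 → Finset (ZMod 3 ⊕ ZMod 3) :=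
  ![{.inl p}, {.inl q, .inr (-p - q)}, {.inl (-p - q), .inr q, .inr p}]

-- Since `p`, `q`, `-p - q` are the three residues, the options of one vertex partition the six
-- colours; equal pairs can thus take different options. The mixed cases are a finite check.
set_option maxRecDepth 100000 in
theorem exists_disjoint_optionColors : ∀ p₀ q₀ p₁ q₁ p₂ q₂ : ZMod 3,
    p₀ ≠ q₀ → p₁ ≠ q₁ → p₂ ≠ q₂ →
    ∃ j₀ j₁ j₂ : Fin 3, Disjoint (optionColors p₀ q₀ j₀) (optionColors p₁ q₁ j₁) ∧
      Disjoint (optionColors p₀ q₀ j₀) (optionColors p₂ q₂ j₂) ∧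
      Disjoint (optionColors p₁ q₁ j₁) (optionColors p₂ q₂ j₂) := by
  decide +kernel

/-- Every option of some pair `(p, q)` is realised at the vertex `v`. -/
def IsSatisfied {V : Type*} (G : SimpleGraph V) (c : Sym2 V → ZMod 3 ⊕ ZMod 3) (D : Set V)
    (v : V) : Prop :=
  ∃ p q : ZMod 3, p ≠ q ∧ ∀ j, JoinedWithin G c D v (optionColors p q j)

theorem IsSatisfied.of_mem {V : Type*} {G : SimpleGraph V} {c : Sym2 V → ZMod 3 ⊕ ZMod 3}
    {D : Set V} {v : V} (hv : v ∈ D) : IsSatisfied G c D v :=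
  ⟨0, 1, by decide, fun _ => .of_mem hv _⟩

theorem exists_disjoint_joinedWithin {V : Type*} {G : SimpleGraph V}
    {c : Sym2 V → ZMod 3 ⊕ ZMod 3} {D : Set V} {v : Fin 3 → V}
    (h : ∀ i, IsSatisfied G c D (v i)) :
    ∃ K : Fin 3 → Finset (ZMod 3 ⊕ ZMod 3), (Pairwise fun i j => Disjoint (K i) (K j)) ∧
      ∀ i, JoinedWithin G c D (v i) (K i) := by
  choose p q hpq hJ using h
  obtain ⟨j₀, j₁, j₂, h01, h02, h12⟩ :=
    exists_disjoint_optionColors _ _ _ _ _ _ (hpq 0) (hpq 1) (hpq 2)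
  refine ⟨fun i => optionColors (p i) (q i) (![j₀, j₁, j₂] i), ?_, fun i => hJ i _⟩
  intro i j hij
  fin_cases i <;> fin_cases j
  · exact absurd rfl hij
  · exact h01
  · exact h02
  · exact h01.symm
  · exact absurd rfl hij
  · exact h12
  · exact h02.symm
  · exact h12.symm
  · exact absurd rfl hij

/-- The subgraph of `G` outside `D`. -/
def outerGraph {V : Type*} (G : SimpleGraph V) (D : Set V) : SimpleGraph V where
  Adj x y := G.Adj x y ∧ x ∉ D ∧ y ∉ D
  symm := ⟨fun _ _ h => ⟨h.1.symm, h.2.2, h.2.1⟩⟩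
  loopless := ⟨fun _ h => h.1.ne rfl⟩

/-- The vertex `x` has at least two neighbours in `D`. -/
def IsTwoLegged {V : Type*} (G : SimpleGraph V) (D : Set V) (x : V) : Prop :=
  ∃ u v, u ∈ D ∧ v ∈ D ∧ u ≠ v ∧ G.Adj x u ∧ G.Adj x v

/-- A depth-first search forest outside `D`, with a chosen child `kid` of each root, and chosen
neighbours `foot` and `foot'` in `D`. -/
structure LeggedForest {V : Type*} (G : SimpleGraph V) (D : Set V) where
  par : V → V
  depth : V → ℕ
  kid : V → V
  foot : V → V
  foot' : V → V
  step : ∀ x, depth x ≠ 0 → (outerGraph G D).Adj x (par x) ∧ depth x = depth (par x) + 1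
  depth_ne : ∀ x y, (outerGraph G D).Adj x y → depth x ≠ depth y
  back : ∀ x y, (outerGraph G D).Adj x y → depth y < depth x →
    y = par x ∨ depth y + 2 ≤ depth x ∧ ∃ y', par y' = y ∧ depth y' = depth y + 1 ∧
      ∃ y'', par y'' = y' ∧ depth y'' = depth y' + 1
  twoLegged_root : ∀ x y, depth x = 0 → (outerGraph G D).Reachable x y → IsTwoLegged G D y →
    IsTwoLegged G D x
  kid_spec : ∀ x, depth x = 0 → (∃ y, par y = x ∧ depth y = 1) →
    par (kid x) = x ∧ depth (kid x) = 1
  foot_spec : ∀ x, x ∉ D → G.Adj x (foot x) ∧ foot x ∈ D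
  foot'_spec : ∀ x, IsTwoLegged G D x → G.Adj x (foot' x) ∧ foot' x ∈ D ∧ foot' x ≠ foot x

theorem exists_leggedForest {V : Type*} [Finite V] {G : SimpleGraph V} {D : Set V}
    (hD : ∀ x, x ∉ D → ∃ u ∈ D, G.Adj x u) : Nonempty (LeggedForest G D) := by
  classical
  obtain ⟨par, d, h1, h2, h3, h4⟩ := exists_dfs_forest (outerGraph G D) (IsTwoLegged G D)
  have hkid : ∀ x, ∃ c, d x = 0 → (∃ y, par y = x ∧ d y = 1) → par c = x ∧ d c = 1 := by
    intro x
    by_cases h : ∃ y, par y = x ∧ d y = 1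
    · exact ⟨h.choose, fun _ _ => h.choose_spec⟩
    · exact ⟨x, fun _ h' => absurd h' h⟩
  choose kid hkid using hkid
  have hfoot : ∀ x, ∃ u, x ∉ D → G.Adj x u ∧ u ∈ D := by
    intro x
    by_cases hx : x ∈ D
    · exact ⟨x, fun h => absurd hx h⟩
    · obtain ⟨u, hu, hxu⟩ := hD x hx
      exact ⟨u, fun _ => ⟨hxu, hu⟩⟩
  choose foot hfoot using hfoot
  have hfoot' : ∀ x, ∃ u, IsTwoLegged G D x → G.Adj x u ∧ u ∈ D ∧ u ≠ foot x := by
    intro x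
    by_cases hx : IsTwoLegged G D x
    · obtain ⟨u, v, hu, hv, huv, hxu, hxv⟩ := hx
      by_cases h : u = foot x
      · exact ⟨v, fun _ => ⟨hxv, hv, fun h' => huv (h.trans h'.symm)⟩⟩
      · exact ⟨u, fun _ => ⟨hxu, hu, h⟩⟩
    · exact ⟨x, fun h => absurd h hx⟩
  choose foot' hfoot' using hfoot'
  exact ⟨⟨par, d, kid, foot, foot', h1, h2, h3, h4, hkid, hfoot, hfoot'⟩⟩

namespace LeggedForest

variable {V : Type*} {G : SimpleGraph V} {D : Set V} (F : LeggedForest G D)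

/-- The type of a vertex is its depth modulo three. -/
def ty (x : V) : ZMod 3 := F.depth x

/-- The vertex `x` has no child. -/
def IsLeaf (x : V) : Prop := ¬ ∃ y, F.par y = x ∧ F.depth y = F.depth x + 1

/-- A leaf of type one with a single leg and a back edge to the root. -/
def IsTrick (x : V) : Prop :=
  F.IsLeaf x ∧ F.ty x = 1 ∧ ¬ IsTwoLegged G D x ∧
    ∃ z, (outerGraph G D).Adj x z ∧ F.depth z = 0 ∧ z ≠ F.par x

/-- The chosen child of a root with a single leg all of whose outer neighbours have type one. -/
def IsSpecial (x : V) : Prop :=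
  F.depth x = 1 ∧ x = F.kid (F.par x) ∧ ¬ IsTwoLegged G D (F.par x) ∧
    ∀ u, (outerGraph G D).Adj (F.par x) u → F.ty u = 1

open Classical in
/-- The colour of the edge from `x` to its ancestor `z`. -/
noncomputable def innerColor (x z : V) : ZMod 3 :=
  -- For `x` of type `p` the default is `p + 1`. The route by the parent is then `{inl (p - 1), inr
  -- (p + 1)}`, and the route by a child is `{inl (p + 1), inr (p - 1)}`.
  if z = F.par x then (if F.IsSpecial x then 1 else if F.IsTrick x then 0 else F.ty x + 1)
  else if F.ty z = F.ty x then F.ty x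
  -- A root has no parent edge and a special `z` has a recoloured one, so the default `p - 1` would
  -- not fit into a route there.
  else if (F.depth z = 0 ∧ F.ty x = 1) ∨ (F.IsSpecial z ∧ F.ty x = 2) then 2
  else F.ty x - 1

open Classical in
/-- The colour of the edge from `x` to the vertex `y` of `D`. -/
noncomputable def legColor (x y : V) : ZMod 3 :=
  if y = F.foot x then F.ty x
  -- The second leg takes the leg colour that the tree does not supply: `p + 1` for a leaf, which
  -- has only a parent, and `p - 1` for a root, which has only children.
  else if y = F.foot' x then (if F.depth x = 0 then F.ty x - 1 else F.ty x + 1)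
  else (if F.depth x = 0 then F.ty x + 1 else F.ty x - 1)

open Classical in
/-- The colour of a pair of vertices. -/
noncomputable def color : Sym2 V → ZMod 3 ⊕ ZMod 3 :=
  Sym2.lift ⟨fun x y =>
    if x ∈ D then (if y ∈ D then .inl 0 else .inl (F.legColor y x))
    else if y ∈ D then .inl (F.legColor x y)
    else if F.depth y < F.depth x then .inr (F.innerColor x y)
    else if F.depth x < F.depth y then .inr (F.innerColor y x) else .inr 0, by
      intro x y
      by_cases hx : x ∈ D <;> by_cases hy : y ∈ D <;> simp only [hx, hy, if_true, if_false]
      rcases lt_trichotomy (F.depth x) (F.depth y) with h | h | h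
      · simp [h, h.not_gt]
      · simp [h]
      · simp [h, h.not_gt]⟩

theorem color_leg {x y : V} (hx : x ∉ D) (hy : y ∈ D) :
    F.color s(x, y) = .inl (F.legColor x y) := by
  simp [color, hx, hy]

theorem color_inner {x y : V} (hxy : (outerGraph G D).Adj x y) (h : F.depth y < F.depth x) :
    F.color s(x, y) = .inr (F.innerColor x y) := by
  simp [color, hxy.2.1, hxy.2.2, h]

/-! #### Legs -/

theorem joined_foot {x : V} (hx : x ∉ D) :
    JoinedWithin G F.color D x {.inl (F.ty x)} := by
  have h := F.foot_spec x hx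
  have := JoinedWithin.of_adj (c := F.color) h.2 h.1
  rwa [F.color_leg hx h.2, legColor, if_pos rfl] at this

theorem joined_foot' {x : V} (hx : x ∉ D) (h2 : IsTwoLegged G D x) :
    JoinedWithin G F.color D x
      {.inl (if F.depth x = 0 then F.ty x - 1 else F.ty x + 1)} := by
  have h := F.foot'_spec x h2
  have := JoinedWithin.of_adj (c := F.color) h.2.1 h.1
  rwa [F.color_leg hx h.2.1, legColor, if_neg h.2.2, if_pos rfl] at this

theorem joined_third {x y : V} (hx : x ∉ D) (hxy : G.Adj x y) (hy : y ∈ D) (h1 : y ≠ F.foot x)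
    (h2 : y ≠ F.foot' x) :
    JoinedWithin G F.color D x
      {.inl (if F.depth x = 0 then F.ty x + 1 else F.ty x - 1)} := by
  have := JoinedWithin.of_adj (c := F.color) hy hxy
  rwa [F.color_leg hx hy, legColor, if_neg h1, if_neg h2] at this

theorem isTwoLegged_of_ne_foot {x y : V} (hx : x ∉ D) (hxy : G.Adj x y) (hy : y ∈ D)
    (h1 : y ≠ F.foot x) : IsTwoLegged G D x :=
  ⟨y, F.foot x, hy, (F.foot_spec x hx).2, h1, hxy, (F.foot_spec x hx).1⟩

theorem joined_up {x z : V} {K : Finset (ZMod 3 ⊕ ZMod 3)} (hz : JoinedWithin G F.color D z K)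
    (hxz : (outerGraph G D).Adj x z) (h : F.depth z < F.depth x) {k : ZMod 3}
    (hk : F.innerColor x z = k) (hK : .inr k ∉ K) :
    JoinedWithin G F.color D x (insert (.inr k) K) := by
  have hc := F.color_inner hxz h
  rw [hk] at hc
  have := hz.cons (u := x) hxz.1 (by rwa [hc])
  rwa [hc] at this

theorem joined_down {x z : V} {K : Finset (ZMod 3 ⊕ ZMod 3)} (hz : JoinedWithin G F.color D z K)
    (hzx : (outerGraph G D).Adj z x) (h : F.depth x < F.depth z) {k : ZMod 3}
    (hk : F.innerColor z x = k) (hK : .inr k ∉ K) :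
    JoinedWithin G F.color D x (insert (.inr k) K) := by
  have hc := F.color_inner hzx h
  rw [hk, Sym2.eq_swap] at hc
  have := hz.cons (u := x) hzx.1.symm (by rwa [hc])
  rwa [hc] at this

/-! #### Structure of the forest -/

theorem ty_of_depth_zero {x : V} (h : F.depth x = 0) : F.ty x = 0 := by simp [ty, h]

theorem ty_of_depth_one {x : V} (h : F.depth x = 1) : F.ty x = 1 := by simp [ty, h]

theorem ty_par {x : V} (h : F.depth x ≠ 0) : F.ty x = F.ty (F.par x) + 1 := by
  simp [ty, (F.step x h).2]

theorem ty_child {x y : V} (h : F.depth y = F.depth x + 1) : F.ty y = F.ty x + 1 := by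
  simp [ty, h]

theorem adj_child {x y : V} (hp : F.par y = x) (h : F.depth y = F.depth x + 1) :
    (outerGraph G D).Adj y x := by
  have := (F.step y (by omega)).1
  rwa [hp] at this

theorem IsLeaf.depth_lt {F : LeggedForest G D} {x z : V} (hx : F.IsLeaf x)
    (hxz : (outerGraph G D).Adj x z) : F.depth z < F.depth x := by
  rcases lt_or_gt_of_ne (F.depth_ne x z hxz) with h | h
  · exfalso
    rcases F.back z x hxz.symm h with rfl | ⟨-, y', h1, h2, -⟩
    · exact hx ⟨z, rfl, (F.step z (by omega)).2⟩
    · exact hx ⟨y', h1, h2⟩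
  · exact h

theorem IsTrick.two_le_depth {F : LeggedForest G D} {x : V} (hx : F.IsTrick x) :
    2 ≤ F.depth x := by
  obtain ⟨hl, -, -, z, hxz, -, hz⟩ := hx
  rcases F.back x z hxz (hl.depth_lt hxz) with h | h
  · exact absurd h hz
  · omega

theorem innerColor_par {x : V} (h1 : ¬ F.IsSpecial x) (h2 : ¬ F.IsTrick x) :
    F.innerColor x (F.par x) = F.ty x + 1 := by
  simp [innerColor, h1, h2]

theorem innerColor_par_of_isSpecial {x : V} (h : F.IsSpecial x) :
    F.innerColor x (F.par x) = 1 := by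
  simp [innerColor, h]

theorem innerColor_par_of_isTrick {x : V} (h : F.IsTrick x) :
    F.innerColor x (F.par x) = 0 := by
  have : ¬ F.IsSpecial x := fun hs => by
    have := h.two_le_depth
    have := hs.1
    omega
  simp [innerColor, h, this]

/-- The root was chosen two-legged whenever its component has a two-legged vertex. -/
theorem IsSpecial.not_isTwoLegged {F : LeggedForest G D} {x : V} (hx : F.IsSpecial x) :
    ¬ IsTwoLegged G D x := by
  have h := F.step x (by rw [hx.1]; exact one_ne_zero)
  have h0 : F.depth (F.par x) = 0 := by
    have := hx.1
    omega
  exact fun h2 => hx.2.2.1 (F.twoLegged_root _ x h0 h.1.symm.reachable h2)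

theorem exists_outer_adj (F : LeggedForest G D)
    (hδ : ∀ x, x ∉ D → ∀ a b, ∃ y, G.Adj x y ∧ y ≠ a ∧ y ≠ b) {x : V} (hx : x ∉ D)
    (h2 : ¬ IsTwoLegged G D x) (a : V) :
    ∃ y, (outerGraph G D).Adj x y ∧ y ≠ a := by
  obtain ⟨y, hy, hya, hyf⟩ := hδ x hx a (F.foot x)
  exact ⟨y, ⟨hy, hx, fun hyD => h2 (F.isTwoLegged_of_ne_foot hx hy hyD hyf)⟩, hya⟩

/-- With a single leg there is an outer neighbour besides the parent; for a leaf it would be joined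
by a back edge, which spans at least two levels, but the depth is one. -/
theorem IsSpecial.not_isLeaf {F : LeggedForest G D}
    (hδ : ∀ x, x ∉ D → ∀ a b, ∃ y, G.Adj x y ∧ y ≠ a ∧ y ≠ b) {x : V} (hx : F.IsSpecial x) :
    ¬ F.IsLeaf x := by
  intro hl
  have h := F.step x (by rw [hx.1]; exact one_ne_zero)
  obtain ⟨y, hxy, hy⟩ := F.exists_outer_adj hδ h.1.2.1 hx.not_isTwoLegged (F.par x)
  rcases F.back x y hxy (hl.depth_lt hxy) with h' | h'
  · exact hy h'
  · have := hx.1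
    omega

/-! #### All vertices are satisfied -/

theorem isSatisfied_intro {v : V} (hv : v ∉ D) {q r : ZMod 3} (hq : F.ty v ≠ q)
    (hr : r = -F.ty v - q)
    (h1 : JoinedWithin G F.color D v {.inl q, .inr r})
    (h2 : JoinedWithin G F.color D v {.inl r, .inr q, .inr (F.ty v)}) :
    IsSatisfied G F.color D v := by
  subst hr
  refine ⟨F.ty v, q, hq, fun j => ?_⟩
  fin_cases j
  · exact F.joined_foot hv
  · exact h1
  · exact h2

end LeggedForest

namespace LeggedForest

variable {V : Type*} {G : SimpleGraph V} {D : Set V} (F : LeggedForest G D)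

theorem IsSpecial.depth_par {F : LeggedForest G D} {x : V} (hx : F.IsSpecial x) :
    F.depth (F.par x) = 0 := by
  have h := F.step x (by rw [hx.1]; exact one_ne_zero)
  have := hx.1
  omega

theorem joined_par {x : V} (hd : F.depth x ≠ 0) (h1 : ¬ F.IsSpecial x) (h2 : ¬ F.IsTrick x) :
    JoinedWithin G F.color D x {.inl (F.ty x - 1), .inr (F.ty x + 1)} := by
  have hs := F.step x hd
  have := F.joined_up (F.joined_foot hs.1.2.2) hs.1 (by omega) (F.innerColor_par h1 h2) (by simp)
  rw [Finset.pair_comm]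
  rwa [F.ty_par hd, add_sub_cancel_right, ← F.ty_par hd]

theorem joined_child {x y : V} (hp : F.par y = x) (hd : F.depth y = F.depth x + 1)
    (h1 : ¬ F.IsSpecial y) (h2 : ¬ F.IsTrick y) :
    JoinedWithin G F.color D x {.inl (F.ty x + 1), .inr (F.ty x - 1)} := by
  have ha := F.adj_child hp hd
  have hc := F.innerColor_par h1 h2
  rw [hp] at hc
  have := F.joined_down (F.joined_foot ha.2.1) ha (by omega) hc (by simp)
  rw [Finset.pair_comm]
  rw [F.ty_child hd] at this
  have e : ∀ p : ZMod 3, p + 1 + 1 = p - 1 := by decide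
  rwa [e] at this

/-- A trick child has type 1, so `x` has type 0 and the recoloured edge has the colour `ty x`; the
larger set allows for it. -/
theorem joined_child' {x y : V} (hp : F.par y = x) (hd : F.depth y = F.depth x + 1)
    (h1 : ¬ F.IsSpecial y) :
    JoinedWithin G F.color D x {.inl (F.ty x + 1), .inr (F.ty x - 1), .inr (F.ty x)} := by
  by_cases h2 : F.IsTrick y
  · have ha := F.adj_child hp hd
    have hc := F.innerColor_par_of_isTrick h2
    rw [hp] at hc
    have := F.joined_down (F.joined_foot ha.2.1) ha (by omega) hc (by simp)
    have e : ∀ p : ZMod 3, p + 1 = 1 → 0 = p := by decide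
    have hx := e _ ((F.ty_child hd).symm.trans h2.2.1)
    rw [F.ty_child hd] at this
    exact this.mono (by rw [← hx]; simp [Finset.insert_subset_iff])
  · exact (F.joined_child hp hd h1 h2).mono (by simp [Finset.insert_subset_iff])

theorem isSatisfied_of_joined {x : V} (hx : x ∉ D)
    (h1 : JoinedWithin G F.color D x {.inl (F.ty x - 1), .inr (F.ty x + 1)})
    (h2 : JoinedWithin G F.color D x {.inl (F.ty x + 1), .inr (F.ty x - 1), .inr (F.ty x)}) :
    IsSatisfied G F.color D x := by
  have e1 : ∀ p : ZMod 3, p ≠ p - 1 := by decide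
  have e2 : ∀ p : ZMod 3, p + 1 = -p - (p - 1) := by decide
  exact F.isSatisfied_intro hx (e1 _) (e2 _) h1 h2

theorem isSatisfied_of_joined' {x : V} (hx : x ∉ D)
    (h1 : JoinedWithin G F.color D x {.inl (F.ty x + 1), .inr (F.ty x - 1)})
    (h2 : JoinedWithin G F.color D x {.inl (F.ty x - 1), .inr (F.ty x + 1), .inr (F.ty x)}) :
    IsSatisfied G F.color D x := by
  have e1 : ∀ p : ZMod 3, p ≠ p + 1 := by decide
  have e2 : ∀ p : ZMod 3, p - 1 = -p - (p + 1) := by decide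
  exact F.isSatisfied_intro hx (e1 _) (e2 _) h1 h2

/-- The parent serves the short option and a child the long one. At a special vertex the roles are
exchanged, since its recoloured parent edge fits only the long option. -/
theorem isSatisfied_of_not_isLeaf {x : V} (hx : x ∉ D) (hd : F.depth x ≠ 0)
    (hl : ¬ F.IsLeaf x) : IsSatisfied G F.color D x := by
  obtain ⟨y, hp, hy⟩ := not_not.1 hl
  have hys : ¬ F.IsSpecial y := fun h => by
    have := h.1
    omega
  by_cases hs : F.IsSpecial x
  · have hx1 := F.ty_of_depth_one hs.1
    have hyt : ¬ F.IsTrick y := fun h => by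
      have h1 := F.ty_child hy
      rw [h.2.1, hx1] at h1
      exact absurd h1 (by decide)
    refine F.isSatisfied_of_joined' hx (F.joined_child hp hy hys hyt) ?_
    have hst := F.step x hd
    have := F.joined_up (F.joined_foot hst.1.2.2) hst.1 (by omega)
      (F.innerColor_par_of_isSpecial hs) (by simp)
    rw [F.ty_of_depth_zero hs.depth_par] at this
    exact this.mono (by rw [hx1]; simp [Finset.insert_subset_iff])
  · exact F.isSatisfied_of_joined hx (F.joined_par hd hs fun h => hl h.1)
      (F.joined_child' hp hy hys)

/-- The back edge to the root, of colour 2, now serves the short option. The long one climbs two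
tree edges, of colours 0 and 1, to a leg of colour 2. -/
theorem isSatisfied_of_isTrick {x : V} (hx : x ∉ D) (ht : F.IsTrick x) :
    IsSatisfied G F.color D x := by
  have hd2 := ht.two_le_depth
  have hst := F.step x (by omega)
  have hl := ht.1
  have hx1 := ht.2.1
  obtain ⟨z, hxz, hz, hzp⟩ := ht.2.2.2
  have hw0 : F.ty (F.par x) = 0 := by
    have e : ∀ p : ZMod 3, 1 = p + 1 → p = 0 := by decide
    exact e _ (hx1.symm.trans (F.ty_par (by omega)))
  have hws : ¬ F.IsSpecial (F.par x) := fun h => by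
    have := F.ty_of_depth_one h.1
    rw [hw0] at this
    exact absurd this (by decide)
  have hwt : ¬ F.IsTrick (F.par x) := fun h => h.1 ⟨x, rfl, hst.2⟩
  refine F.isSatisfied_of_joined hx ?_ ?_
  · have hc : F.innerColor x z = 2 := by
      rw [innerColor, if_neg hzp, F.ty_of_depth_zero hz, hx1, if_neg (by decide),
        if_pos (.inl ⟨hz, rfl⟩)]
    have := F.joined_up (F.joined_foot hxz.2.2) hxz (by omega) hc (by simp)
    rw [F.ty_of_depth_zero hz] at this
    exact this.mono (by rw [hx1]; simp [Finset.insert_subset_iff]; decide)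
  · have h1 := F.joined_par (x := F.par x) (by omega) hws hwt
    rw [hw0] at h1
    have := F.joined_up h1 hst.1 (by omega) (F.innerColor_par_of_isTrick ht) (by decide)
    exact this.mono (by rw [hx1]; decide)

/-- The parent serves the short option. The long one needs a leg of colour `p + 1`: a second leg of
`x`, or one reached by a back edge to `z`. According as `z` has type `p + 1`, `p` or `p - 1`, it is
the leg of `z`, of a child of `z`, or of the parent of `z`. -/
theorem isSatisfied_of_isLeaf
    (hδ : ∀ x, x ∉ D → ∀ a b, ∃ y, G.Adj x y ∧ y ≠ a ∧ y ≠ b) {x : V} (hx : x ∉ D)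
    (hd : F.depth x ≠ 0) (hl : F.IsLeaf x) : IsSatisfied G F.color D x := by
  have hs : ¬ F.IsSpecial x := fun h => h.not_isLeaf hδ hl
  by_cases ht : F.IsTrick x
  · exact F.isSatisfied_of_isTrick hx ht
  refine F.isSatisfied_of_joined hx (F.joined_par hd hs ht) ?_
  by_cases h2 : IsTwoLegged G D x
  · have := F.joined_foot' hx h2
    rw [if_neg hd] at this
    exact this.mono (by simp)
  obtain ⟨z, hxz, hz⟩ := F.exists_outer_adj hδ hx h2 (F.par x)
  have hlt := hl.depth_lt hxz
  obtain ⟨hd2, y, hyz, hy, y', hy'y, hy'⟩ := (F.back x z hxz hlt).resolve_left hz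
  -- Having children, `z` and `y` are not tricks, so their parent edges are not recoloured for that
  -- reason.
  have hyl : ¬ F.IsLeaf y := fun h => h ⟨y', hy'y, hy'⟩
  have hzl : ¬ F.IsLeaf z := fun h => h ⟨y, hyz, hy⟩
  have e0 : ∀ p : ZMod 3, p + 1 ≠ p := by decide
  have e1 : ∀ p : ZMod 3, p - 1 ≠ p := by decide
  have e2 : ∀ p : ZMod 3, p - 1 - 1 = p + 1 := by decide
  have tri : ∀ p z : ZMod 3, z = p + 1 ∨ z = p ∨ z = p - 1 := by decide
  rcases tri (F.ty x) (F.ty z) with hty | hty | hty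
  · have hc : F.innerColor x z = F.ty x - 1 := by
      rw [innerColor, if_neg hz, if_neg (by rw [hty]; exact e0 _), if_neg]
      rintro (⟨h0, h1⟩ | ⟨h0, h1⟩)
      · rw [F.ty_of_depth_zero h0, h1] at hty
        exact absurd hty (by decide)
      · rw [F.ty_of_depth_one h0.1, h1] at hty
        exact absurd hty (by decide)
    have := F.joined_up (F.joined_foot hxz.2.2) hxz hlt hc (by simp)
    rw [hty] at this
    exact this.mono (by simp [Finset.insert_subset_iff])
  · have hc : F.innerColor x z = F.ty x := by
      rw [innerColor, if_neg hz, if_pos hty]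
    -- Otherwise `z` is a root whose outer neighbours all have type 1, whereas `x` has type 0.
    have hys : ¬ F.IsSpecial y := by
      intro h
      have h0 := h.depth_par
      have h1 := h.2.2.2 x (by rw [hyz]; exact hxz.symm)
      rw [hyz] at h0
      rw [F.ty_of_depth_zero h0, h1] at hty
      exact absurd hty (by decide)
    have h1 := F.joined_child hyz hy hys fun h => hyl h.1
    rw [hty] at h1
    have := F.joined_up h1 hxz hlt hc (by simpa using (e1 _).symm)
    exact this.mono (by simp [Finset.insert_subset_iff])
  -- If `z` were a root, `x` would have type 1 and be a trick.
  · have hz0 : F.depth z ≠ 0 := by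
      intro h0
      rw [F.ty_of_depth_zero h0] at hty
      have e : ∀ p : ZMod 3, 0 = p - 1 → p = 1 := by decide
      exact ht ⟨hl, e _ hty, h2, z, hxz, h0, hz⟩
    have hst := F.step z hz0
    by_cases hzs : F.IsSpecial z
    · have hx2 : F.ty x = 2 := by
        rw [F.ty_of_depth_one hzs.1] at hty
        have e : ∀ p : ZMod 3, 1 = p - 1 → p = 2 := by decide
        exact e _ hty
      have hc : F.innerColor x z = 2 := by
        rw [innerColor, if_neg hz, if_neg (by rw [hty]; exact e1 _), if_pos (.inr ⟨hzs, hx2⟩)]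
      have h1 := F.joined_up (F.joined_foot hst.1.2.2) hst.1 (by omega)
        (F.innerColor_par_of_isSpecial hzs) (by simp)
      rw [F.ty_of_depth_zero hzs.depth_par] at h1
      have := F.joined_up h1 hxz hlt hc (by decide)
      exact this.mono (by rw [hx2]; decide)
    · have hc : F.innerColor x z = F.ty x - 1 := by
        rw [innerColor, if_neg hz, if_neg (by rw [hty]; exact e1 _), if_neg]
        rintro (⟨h0, -⟩ | ⟨h0, -⟩)
        · exact hz0 h0
        · exact hzs h0
      have h1 := F.joined_par hz0 hzs fun h => hzl h.1
      rw [hty, e2, sub_add_cancel] at h1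
      have := F.joined_up h1 hxz hlt hc (by simp)
      exact this.mono (by simp [Finset.insert_subset_iff])

theorem not_isTrick_of_depth_one {x : V} (h : F.depth x = 1) : ¬ F.IsTrick x := fun ht => by
  have := ht.two_le_depth
  omega

/-- A child serves the short option `{inl 1, inr 2}`. The long one comes from a second leg, or from
a back edge to a descendant of type 0 or 2. If there is neither, the special child serves the long
option and another outer neighbour the short one. A root without outer neighbours has three legs. -/
theorem isSatisfied_of_root
    (hδ : ∀ x, x ∉ D → ∀ a b, ∃ y, G.Adj x y ∧ y ≠ a ∧ y ≠ b) {x : V} (hx : x ∉ D)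
    (hd : F.depth x = 0) : IsSatisfied G F.color D x := by
  have hx0 := F.ty_of_depth_zero hd
  by_cases hn : ∃ v, (outerGraph G D).Adj x v
  · obtain ⟨hcp, hcd⟩ : F.par (F.kid x) = x ∧ F.depth (F.kid x) = 1 := by
      refine F.kid_spec x hd ?_
      obtain ⟨v, hxv⟩ := hn
      have hlt : F.depth x < F.depth v := by
        have := F.depth_ne x v hxv
        omega
      rcases F.back v x hxv.symm hlt with h | ⟨-, y, h1, h2, -⟩
      · exact ⟨v, h.symm, by rw [(F.step v (by omega)).2, ← h, hd]⟩
      · exact ⟨y, h1, by rw [h2, hd]⟩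
    have hcd' : F.depth (F.kid x) = F.depth x + 1 := by rw [hcd, hd]
    have hct := F.not_isTrick_of_depth_one hcd
    have hca := F.adj_child hcp hcd'
    by_cases h2 : IsTwoLegged G D x
    · refine F.isSatisfied_of_joined' hx (F.joined_child hcp hcd' ?_ hct) ?_
      · intro h
        have := h.2.2.1
        rw [hcp] at this
        exact this h2
      · have := F.joined_foot' hx h2
        rw [if_pos hd] at this
        exact this.mono (by simp)
    · by_cases hall : ∀ u, (outerGraph G D).Adj x u → F.ty u = 1
      · have hcs : F.IsSpecial (F.kid x) :=
          ⟨hcd, by rw [hcp], by rwa [hcp], by rwa [hcp]⟩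
        obtain ⟨y, hyp, hyd⟩ := not_not.1 (hcs.not_isLeaf hδ)
        refine F.isSatisfied_of_joined' hx ?_ ?_
        · obtain ⟨u, hxu, huc⟩ := F.exists_outer_adj hδ hx h2 (F.kid x)
          have hlt : F.depth x < F.depth u := by
            have := F.depth_ne x u hxu
            omega
          have hu1 := hall u hxu
          have hc : F.innerColor u x = 2 := by
            by_cases hup : x = F.par u
            · have hud : F.depth u = 1 := by
                rw [(F.step u (by omega)).2, ← hup, hd]
              have hus : ¬ F.IsSpecial u := fun h => huc (by rw [hup]; exact h.2.1)
              rw [hup, F.innerColor_par hus (F.not_isTrick_of_depth_one hud), hu1]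
              decide
            · rw [innerColor, if_neg hup, hx0, hu1, if_neg (by decide), if_pos (.inl ⟨hd, rfl⟩)]
          have := F.joined_down (F.joined_foot hxu.2.2) hxu.symm hlt hc (by simp)
          rw [hu1] at this
          exact this.mono (by rw [hx0]; decide)
        · have hys : ¬ F.IsSpecial y := fun h => by
            have := h.1
            omega
          have hc1 := F.ty_of_depth_one hcd
          have hyt : ¬ F.IsTrick y := fun h => by
            have h1 := F.ty_child hyd
            rw [h.2.1, hc1] at h1
            exact absurd h1 (by decide)
          have h1 := F.joined_child hyp hyd hys hyt
          have hc := F.innerColor_par_of_isSpecial hcs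
          rw [hcp] at hc
          rw [hc1] at h1
          have := F.joined_down h1 hca (by omega) hc (by decide)
          exact this.mono (by rw [hx0]; decide)
      · have hcs : ¬ F.IsSpecial (F.kid x) := fun h => by
          have := h.2.2.2
          rw [hcp] at this
          exact hall this
        refine F.isSatisfied_of_joined' hx (F.joined_child hcp hcd' hcs hct) ?_
        push Not at hall
        obtain ⟨u, hxu, hu1⟩ := hall
        have hlt : F.depth x < F.depth u := by
          have := F.depth_ne x u hxu
          omega
        have hup : x ≠ F.par u := by
          intro h
          apply hu1
          rw [F.ty_par (by omega), ← h, hx0]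
          decide
        have hus : ¬ F.IsSpecial u := fun h => hu1 (F.ty_of_depth_one h.1)
        have hut : ¬ F.IsTrick u := fun h => hu1 h.2.1
        have hxs : ¬ F.IsSpecial x := fun h => by
          have := h.1
          omega
        have e : ∀ p : ZMod 3, p ≠ 1 → p = 0 ∨ p = 2 := by decide
        rcases e _ hu1 with hu | hu
        · have hc : F.innerColor u x = 0 := by
            rw [innerColor, if_neg hup, hx0, hu, if_pos rfl]
          have h1 := F.joined_par (x := u) (by omega) hus hut
          rw [hu] at h1
          have := F.joined_down h1 hxu.symm hlt hc (by decide)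
          exact this.mono (by rw [hx0]; decide)
        · have hc : F.innerColor u x = 1 := by
            rw [innerColor, if_neg hup, hx0, hu, if_neg (by decide), if_neg]
            · decide
            · rintro (⟨-, h⟩ | ⟨h, -⟩)
              · exact absurd h (by decide)
              · exact hxs h
          have := F.joined_down (F.joined_foot hxu.2.2) hxu.symm hlt hc (by simp)
          rw [hu] at this
          exact this.mono (by rw [hx0]; decide)
  · push Not at hn
    have hD : ∀ y, G.Adj x y → y ∈ D := by
      intro y hxy
      by_contra hy
      exact hn y ⟨hxy, hx, hy⟩
    obtain ⟨y, hxy, hyf, -⟩ := hδ x hx (F.foot x) (F.foot x)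
    have h2 := F.isTwoLegged_of_ne_foot hx hxy (hD y hxy) hyf
    obtain ⟨z, hxz, hzf, hzf'⟩ := hδ x hx (F.foot x) (F.foot' x)
    have h3 := F.joined_third hx hxz (hD z hxz) hzf hzf'
    have h4 := F.joined_foot' hx h2
    rw [if_pos hd] at h3 h4
    exact F.isSatisfied_of_joined' hx (h3.mono (by simp)) (h4.mono (by simp))

theorem isSatisfied (hδ : ∀ x, x ∉ D → ∀ a b, ∃ y, G.Adj x y ∧ y ≠ a ∧ y ≠ b) (x : V) :
    IsSatisfied G F.color D x := by
  by_cases hx : x ∈ D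
  · exact .of_mem hx
  by_cases hd : F.depth x = 0
  · exact F.isSatisfied_of_root hδ hx hd
  by_cases hl : F.IsLeaf x
  · exact F.isSatisfied_of_isLeaf hδ hx hd hl
  · exact F.isSatisfied_of_not_isLeaf hx hd hl

end LeggedForest

/-! ### The bound from a dominating walk -/

theorem JoinedWithin.mapLe {V C C' : Type*} [DecidableEq C'] {G G' : SimpleGraph V}
    {c : Sym2 V → C} {c' : Sym2 V → C'} {D : Set V} {v : V} {K : Finset C} {φ : C → C'}
    (h : JoinedWithin G' c D v K) (hle : G' ≤ G) (hφ : Function.Injective φ)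
    (hc : ∀ e ∈ G'.edgeSet, c' e = φ (c e)) : JoinedWithin G c' D v (K.image φ) := by
  obtain ⟨d, hd, w, hw, hi⟩ := h
  refine ⟨d, hd, w.mapLe hle, ?_, ?_⟩
  · intro e he
    rw [Walk.edges_mapLe_eq_edges] at he
    rw [hc e (w.edges_subset_edgeSet he)]
    exact Finset.mem_image_of_mem _ (hw e he)
  · intro e he f hf hef
    simp only [Walk.edges_mapLe_eq_edges, Set.mem_ofPred_eq] at he hf
    rw [hc e (w.edges_subset_edgeSet he), hc f (w.edges_subset_edgeSet hf)] at hef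
    exact hi he hf (hφ hef)

/-- A dominating walk of length `ℓ` in a graph of minimum degree at least three shows that the
`3`-rainbow index is at most `ℓ + 6`. -/
theorem rainbowIndex_le_of_dominating_walk {V : Type*} [Finite V] {G : SimpleGraph V}
    (hδ : ∀ x a b : V, ∃ y, G.Adj x y ∧ y ≠ a ∧ y ≠ b) {u v : V} {p : G.Walk u v}
    (hdom : ∀ x, x ∉ p.support → ∃ y ∈ p.support, G.Adj x y) :
    rainbowIndex 3 G ≤ (p.length + 6 : ℕ) := by
  classical
  let D : Set V := {x | x ∈ p.support}
  -- Edges inside `D` are removed so that routes to `D` never use an edge of the walk, whose colours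
  -- are reserved.
  let G' : SimpleGraph V :=
    { Adj := fun x y => G.Adj x y ∧ ¬ (x ∈ D ∧ y ∈ D)
      symm := ⟨fun _ _ h => ⟨h.1.symm, fun h' => h.2 h'.symm⟩⟩
      loopless := ⟨fun _ h => h.1.ne rfl⟩ }
  have hδ' : ∀ x, x ∉ D → ∀ a b, ∃ y, G'.Adj x y ∧ y ≠ a ∧ y ≠ b := by
    intro x hx a b
    obtain ⟨y, hxy, h⟩ := hδ x a b
    exact ⟨y, ⟨hxy, fun h' => hx h'.1⟩, h⟩
  have hdom' : ∀ x, x ∉ D → ∃ y ∈ D, G'.Adj x y := by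
    intro x hx
    obtain ⟨y, hy, hxy⟩ := hdom x hx
    exact ⟨y, hy, hxy, fun h' => hx h'.1⟩
  obtain ⟨F⟩ := exists_leggedForest hdom'
  let c : Sym2 V → Fin p.length ⊕ (ZMod 3 ⊕ ZMod 3) := fun e =>
    -- First occurrence in the list: an edge traversed twice still has one colour.
    if h : e ∈ p.edges then .inl ⟨p.edges.idxOf e, by
      rw [← p.length_edges]
      exact List.idxOf_lt_length_iff.2 h⟩
    else .inr (F.color e)
  have hcG' : ∀ e ∈ G'.edgeSet, c e = .inr (F.color e) := by
    intro e he
    refine dif_neg fun h => ?_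
    induction e with
    | _ x y => exact he.2 ⟨p.fst_mem_support_of_mem_edges h, p.snd_mem_support_of_mem_edges h⟩
  refine rainbowIndex_le_of_coloring (C := Fin p.length ⊕ (ZMod 3 ⊕ ZMod 3)) ?_ c fun x => ?_
  · simp [ZMod.card]
  obtain ⟨K, hK, hx⟩ := exists_disjoint_joinedWithin (v := x) fun i => F.isSatisfied hδ' (x i)
  refine exists_connected_of_joinedWithin (D := D) (K₀ := Finset.univ.image .inl) (c := c) ?_ x
    (fun i => (K i).image .inr) ?_ ?_ ?_
  · intro f hf
    refine ⟨p.toSubgraph, p.toSubgraph_connected, fun i => p.mem_verts_toSubgraph.2 (hf i), ?_, ?_⟩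
    · intro e he g hg heg
      rw [Walk.mem_edges_toSubgraph] at he hg
      simp only [c, dif_pos he, dif_pos hg, Sum.inl.injEq, Fin.mk.injEq] at heg
      exact (List.idxOf_inj he).1 heg
    · intro e he
      rw [Walk.mem_edges_toSubgraph] at he
      simp [c, dif_pos he]
  · intro i
    rw [Finset.disjoint_left]
    simp
  · intro i j hij
    exact (Finset.disjoint_image Sum.inr_injective).2 (hK hij)
  · intro i
    exact (hx i).mapLe (fun _ _ h => h.1) Sum.inr_injective hcG'

/-! ### Interval graphs -/

theorem ordConnected_iUnion_support {V : Type*} {G : SimpleGraph V} {I : V → Set ℝ}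
    (hI : ∀ v, (I v).OrdConnected) (hadj : ∀ u v, G.Adj u v → (I u ∩ I v).Nonempty) {u v : V}
    (p : G.Walk u v) : (⋃ x ∈ p.support, I x).OrdConnected := by
  induction p with
  | nil => simpa using hI _
  | @cons u w v h p ih =>
    obtain ⟨x, hxu, hxw⟩ := hadj _ _ h
    have hU : (⋃ y ∈ (Walk.cons h p).support, I y) = I u ∪ ⋃ y ∈ p.support, I y := by
      ext z
      simp
    rw [hU]
    have hx : x ∈ ⋃ y ∈ p.support, I y := Set.mem_iUnion₂.2 ⟨w, p.start_mem_support, hxw⟩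
    exact (IsPreconnected.union x hxu hx (hI u).isPreconnected ih.isPreconnected).ordConnected

theorem Set.OrdConnected.inter_nonempty_of_le {s t : Set ℝ} (hs : s.OrdConnected)
    (ht : t.OrdConnected) {a b y z : ℝ} (ha : a ∈ s) (hb : b ∈ s) (hy : y ∈ t) (hz : z ∈ t)
    (hay : a ≤ y) (hzb : z ≤ b) : (t ∩ s).Nonempty := by
  rcases le_total y b with h | h
  · exact ⟨y, hy, hs.out ha hb ⟨hay, h⟩⟩
  · exact ⟨b, ht.out hz hy ⟨hzb, h⟩, hb⟩

/-- Lower sets of a linear order form a chain, so some `I L` has the smallest lower closure: its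
right end is leftmost, whether or not it is attained. -/
theorem exists_forall_exists_le {V : Type*} [Finite V] [Nonempty V] {α : Type*} [LinearOrder α]
    (I : V → Set α) : ∃ L, ∀ v, ∀ x ∈ I L, ∃ y ∈ I v, x ≤ y := by
  have htot : ∀ u v, lowerClosure (I u) ≤ lowerClosure (I v) ∨
      lowerClosure (I v) ≤ lowerClosure (I u) := fun u v => by
    simpa [← SetLike.coe_subset_coe] using
      (lowerClosure (I u)).lower.total (lowerClosure (I v)).lower
  obtain ⟨L, -, hL⟩ := Set.Finite.exists_minimalFor (fun v => lowerClosure (I v)) Set.univ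
    Set.finite_univ Set.univ_nonempty
  refine ⟨L, fun v x hx => ?_⟩
  have hle : lowerClosure (I L) ≤ lowerClosure (I v) := by
    rcases htot L v with h | h
    · exact h
    · exact hL (Set.mem_univ v) h
  exact mem_lowerClosure.1 (hle (subset_lowerClosure hx))

theorem IsIntervalGraph.rainbowIndex_le {V : Type*} [Finite V] {G : SimpleGraph V}
    (hconn : G.Connected) (hG : IsIntervalGraph G)
    (hδ : ∀ x a b : V, ∃ y, G.Adj x y ∧ y ≠ a ∧ y ≠ b) :
    rainbowIndex 3 G ≤ (G.diam : ℕ∞) + 4 := by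
  classical
  have := hconn.nonempty
  obtain ⟨I, hI, hadj⟩ := hG
  have hediam := connected_iff_ediam_ne_top.1 hconn
  obtain ⟨L, hL⟩ := exists_forall_exists_le I
  obtain ⟨R, hR⟩ := exists_forall_exists_le (α := ℝᵒᵈ) I
  -- The order dual unfolded: the left end of `I R` is rightmost.
  have hR : ∀ v, ∀ x ∈ I R, ∃ y ∈ I v, y ≤ x := hR
  by_cases hLR : (I L ∩ I R).Nonempty
  · obtain ⟨x, hxL, hxR⟩ := hLR
    have hall : ∀ v, x ∈ I v := by
      intro v
      obtain ⟨y, hy, hxy⟩ := hL v x hxL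
      obtain ⟨z, hz, hzx⟩ := hR v x hxR
      exact (hI v).2.out hz hy ⟨hzx, hxy⟩
    -- All intervals share `x`, so the graph is complete, hence threshold, and `5 ≤ diam + 4`.
    have hthr : IsThresholdGraph G :=
      ⟨fun _ => 0, 0, fun u v huv => by simpa using (hadj u v huv).2 ⟨x, hall u, hall v⟩⟩
    have hdiam : 1 ≤ G.diam := by
      obtain ⟨y, hy, -⟩ := hδ L L L
      have h1 := G.dist_le_diam hediam (u := L) (v := y)
      have h2 := hconn.pos_dist_of_ne hy.ne
      omega
    refine (hthr.rainbowIndex_le hδ).trans ?_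
    have : ((1 + 4 : ℕ) : ℕ∞) ≤ ((G.diam + 4 : ℕ) : ℕ∞) := by
      rw [Nat.cast_le]
      omega
    exact_mod_cast this
  · have hadj' : ∀ u v, G.Adj u v → (I u ∩ I v).Nonempty := fun u v h => (hadj u v h.ne).1 h
    obtain ⟨w, hw⟩ := hconn.exists_walk_length_eq_dist L R
    have hlen : w.length ≤ G.diam := hw ▸ G.dist_le_diam hediam
    -- Both ends of a shortest walk from `L` to `R` are dropped. The rest still dominates: its union
    -- is an interval meeting `I L` and `I R`, and every interval reaches to the right of any point
    -- of `I L` and to the left of any point of `I R`.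
    obtain ⟨l, r, q, hl, hr, hq⟩ : ∃ l r, ∃ q : G.Walk l r, (I L ∩ I l).Nonempty ∧
        (I R ∩ I r).Nonempty ∧ q.length + 2 ≤ G.diam := by
      cases w with
      | nil => exact absurd (by rw [Set.inter_self]; exact (hI L).1) hLR
      | @cons _ l _ h w =>
        rw [Walk.length_cons] at hlen
        obtain ⟨q, hq⟩ : ∃ q : G.Walk R l, q.length = w.length := ⟨w.reverse, by simp⟩
        cases q with
        | nil => exact absurd (hadj' _ _ h) hLR
        | @cons _ r _ h' q =>
          rw [Walk.length_cons] at hq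
          exact ⟨l, r, q.reverse, hadj' _ _ h, hadj' _ _ h', by
            rw [Walk.length_reverse]
            omega⟩
    have hU := ordConnected_iUnion_support (fun v => (hI v).2) hadj' q
    refine (rainbowIndex_le_of_dominating_walk hδ (p := q) fun x hx => ?_).trans ?_
    · obtain ⟨a, haL, ha⟩ := hl
      obtain ⟨b, hbR, hb'⟩ := hr
      obtain ⟨y, hy, hay⟩ := hL x a haL
      obtain ⟨z, hz, hzb⟩ := hR x b hbR
      obtain ⟨s, hs, hsU⟩ := Set.OrdConnected.inter_nonempty_of_le hU (hI x).2
        (Set.mem_iUnion₂.2 ⟨_, q.start_mem_support, ha⟩)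
        (Set.mem_iUnion₂.2 ⟨_, q.end_mem_support, hb'⟩) hy hz hay hzb
      obtain ⟨u, hu, hsu⟩ := Set.mem_iUnion₂.1 hsU
      exact ⟨u, hu, (hadj x u (by rintro rfl; exact hx hu)).2 ⟨s, hs, hsu⟩⟩
    · have : ((q.length + 6 : ℕ) : ℕ∞) ≤ ((G.diam + 4 : ℕ) : ℕ∞) := by
        rw [Nat.cast_le]
        omega
      exact_mod_cast this

/-! ### Tools for the extremal examples -/

/-- Applied to colour patterns; this is the origin of the thresholds `2 * 4 ^ 3 + 1`, `2 * 5 ^ 3 +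
4` and `2 * 5 ^ 6 + 1`. -/
theorem exists_three_of_mul_lt_card {α β : Type*} [Fintype α] [Fintype β] (f : α → β)
    (h : 2 * Fintype.card β < Fintype.card α) :
    ∃ (g : Fin 3 → α) (b : β), Function.Injective g ∧ ∀ i, f (g i) = b := by
  classical
  obtain ⟨b, hb⟩ := Fintype.exists_lt_card_fiber_of_mul_lt_card f (by rwa [mul_comm])
  obtain ⟨x, y, z, hx, hy, hz, hxy, hxz, hyz⟩ := Finset.two_lt_card_iff.1 hb
  simp only [Finset.mem_filter, Finset.mem_univ, true_and] at hx hy hz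
  refine ⟨![x, y, z], b, ?_, ?_⟩
  · intro i j hij
    fin_cases i <;> fin_cases j <;> simp_all [eq_comm]
  · intro i
    fin_cases i
    · exact hx
    · exact hy
    · exact hz

theorem three_le_minDegree {V : Type*} [Fintype V] [Nonempty V] {G : SimpleGraph V}
    [DecidableRel G.Adj]
    (h : ∀ v, ∃ f : Fin 3 → V, Function.Injective f ∧ ∀ i, G.Adj v (f i)) : 3 ≤ G.minDegree := by
  refine G.le_minDegree_of_forall_le_degree 3 fun v => ?_
  obtain ⟨f, hf, hadj⟩ := h v
  have := Finset.card_le_card_of_injOn (s := Finset.univ) (t := G.neighborFinset v) f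
    (fun i _ => by simpa using hadj i) hf.injOn
  simpa using this

theorem card_univ_image_fin_three {V : Type*} [DecidableEq V] {x : Fin 3 → V}
    (hx : Function.Injective x) : (Finset.univ.image x).card = 3 := by
  rw [Finset.card_image_of_injective _ hx, Finset.card_univ, Fintype.card_fin]

/-- Three vertices whose neighbours are exactly `y 0, y 1, y 2`, joined to `y j` by edges of the
same colour: every rainbow tree containing them contains `y 0, y 1, y 2`. -/
theorem IsRainbowTree.mem_verts_of_twins {V : Type*} {G : SimpleGraph V} {t : ℕ}
    {c : G.edgeSet → Fin t} {S : Finset V} {T : G.Subgraph} (hT : IsRainbowTree c S T)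
    {x y : Fin 3 → V} (hx : Function.Injective x) (hxS : ∀ i, x i ∈ S)
    (hxy : ∀ i j, G.Adj (x i) (y j)) (hnb : ∀ i v, G.Adj (x i) v → v ∈ Set.range y)
    {κ : Fin 3 → Fin t} (hκ : ∀ i j, c ⟨s(x i, y j), hxy i j⟩ = κ j) (j : Fin 3) :
    y j ∈ T.verts := by
  have hx' : ∀ i i' j, x i ≠ y j → s(x i, y j) = s(x i', y j) → i = i' := by
    intro i i' j hne h
    rcases Sym2.eq_iff.1 h with ⟨h, -⟩ | ⟨h, -⟩
    · exact hx h
    · exact absurd h hne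
  have hadj : ∀ i, ∃ j, T.Adj (x i) (y j) := by
    intro i
    obtain ⟨i', hi'⟩ := exists_ne i
    obtain ⟨u, hu, v, -, huv⟩ := exists_adj_of_connected hT.isTree.connected (A := {x i})
      (hT.subset_verts (hxS i)) rfl (hT.subset_verts (hxS i')) (fun h => hi' (hx h))
    obtain rfl := hu
    obtain ⟨j, rfl⟩ := hnb i v (T.adj_sub huv)
    exact ⟨j, huv⟩
  choose σ hσ using hadj
  -- Edges from different `x i` to the same `y j` share a colour, so the three `x i` leave by
  -- different `y j`.
  have hσi : Function.Injective σ := by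
    intro i i' h
    have h1 := hT.isRainbow ⟨s(x i, y (σ i)), hxy _ _⟩ ⟨s(x i', y (σ i')), hxy _ _⟩ (hσ i) (hσ i')
      (by rw [hκ, hκ, h])
    have h2 := congrArg Subtype.val h1
    dsimp only at h2
    rw [← h] at h2
    exact hx' i i' _ (hxy _ _).ne h2
  obtain ⟨i, rfl⟩ := Finite.surjective_of_injective hσi j
  exact T.edge_vert (hσ i).symm

theorem six_le_ncard {V : Type*} [Finite V] {s : Set V} {x y : Fin 3 → V}
    (hx : Function.Injective x) (hy : Function.Injective y) (hxy : ∀ i j, x i ≠ y j)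
    (hxs : ∀ i, x i ∈ s) (hys : ∀ i, y i ∈ s) : 6 ≤ s.ncard := by
  have hinj : Function.Injective (Sum.elim x y) := hx.sumElim hy hxy
  have h := Set.ncard_le_ncard (s := Set.range (Sum.elim x y)) (t := s)
    (by rintro _ ⟨i | i, rfl⟩ <;> simp [hxs, hys]) (Set.toFinite s)
  rw [Set.ncard_range_of_injective hinj] at h
  simpa using h

/-! ### The threshold example -/

theorem thresholdExample_adj_inr_inl (t : ℕ) (j : Fin t) (i : Fin 3) :
    (thresholdExample t).Adj (.inr j) (.inl i) := ⟨by simp, by simp⟩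

theorem isThresholdGraph_thresholdExample (t : ℕ) : IsThresholdGraph (thresholdExample t) := by
  refine ⟨Sum.elim (fun _ => 1) (fun _ => 0), 1, ?_⟩
  rintro (i | i) (j | j) h <;> simp [thresholdExample] at h ⊢
  exact h

theorem connected_thresholdExample (t : ℕ) : (thresholdExample t).Connected := by
  rw [connected_iff_exists_forall_reachable]
  refine ⟨.inl 0, fun v => ?_⟩
  by_cases h : Sum.inl 0 = v
  · rw [h]
  · exact Adj.reachable ⟨h, by simp⟩

theorem three_le_minDegree_thresholdExample {t : ℕ} (ht : 3 ≤ t) :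
    3 ≤ (thresholdExample t).minDegree := by
  refine three_le_minDegree ?_
  rintro (i | j)
  · exact ⟨fun k => .inr (Fin.castLE ht k), fun a b h => by simpa using h,
      fun k => (thresholdExample_adj_inr_inl t _ i).symm⟩
  · exact ⟨.inl, Sum.inl_injective, thresholdExample_adj_inr_inl t j⟩

theorem five_le_rainbowIndex_thresholdExample {t : ℕ} (ht : 2 * 4 ^ 3 + 1 ≤ t) :
    5 ≤ rainbowIndex 3 (thresholdExample t) := by
  classical
  refine le_rainbowIndex (n := 5) fun n c hc => ?_
  by_contra! hn
  obtain ⟨g, κ, hg, hκ⟩ := exists_three_of_mul_lt_card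
    (fun (j : Fin t) (i : Fin 3) =>
      c ⟨s(.inr j, .inl i), thresholdExample_adj_inr_inl t j i⟩) (by
      have : n ^ 3 ≤ 4 ^ 3 := Nat.pow_le_pow_left (by omega) 3
      simp
      omega)
  have hx : Function.Injective fun i => (Sum.inr (g i) : Fin 3 ⊕ Fin t) :=
    Sum.inr_injective.comp hg
  obtain ⟨T, hT⟩ := hc _ (card_univ_image_fin_three hx)
  have hxS : ∀ i, Sum.inr (g i) ∈ Finset.univ.image fun i => (Sum.inr (g i) : Fin 3 ⊕ Fin t) :=
    fun i => Finset.mem_image_of_mem _ (Finset.mem_univ i)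
  have hy := hT.mem_verts_of_twins hx hxS (y := .inl)
    (fun i j => thresholdExample_adj_inr_inl t (g i) j) (by
      rintro i (v | v) hv
      · exact ⟨v, rfl⟩
      · simp [thresholdExample] at hv) (fun i j => congrFun (hκ i) j)
  have h1 := six_le_ncard hx Sum.inl_injective (by simp) (fun i => hT.subset_verts (hxS i)) hy
  have h2 := hT.ncard_verts_le'
  omega

/-! ### The chain example -/

theorem chainExample_adj {k t : ℕ} {i : Fin k} {j : Fin t} :
    (chainExample k t).Adj (.inl i) (.inr j) ↔ (j : ℕ) < 3 ∨ k ≤ (i : ℕ) + 3 := Iff.rfl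

theorem isChainGraph_chainExample (k t : ℕ) : IsChainGraph (chainExample k t) := by
  refine ⟨Set.range .inl, Set.range .inr, ⟨?_, ?_⟩, Set.range_inl_union_range_inr, k, .inl,
    Sum.inl_injective, rfl, ?_⟩
  · exact Set.isCompl_range_inl_range_inr.disjoint
  · rintro (i | i) (j | j) h
    · exact h.elim
    · simp
    · simp
    · exact h.elim
  · rintro i i' hi (j | j) h
    · exact h.elim
    · exact Or.imp_right (fun h' : k ≤ (i : ℕ) + 3 => h'.trans (Nat.add_le_add_right hi 3)) h

/-- The three last vertices on the left. -/
def lastLeft {k : ℕ} (hk : 3 ≤ k) (i : Fin 3) : Fin k := ⟨k - 3 + i, by omega⟩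

theorem lastLeft_injective {k : ℕ} (hk : 3 ≤ k) : Function.Injective (lastLeft hk) := by
  intro i j h
  simp only [lastLeft, Fin.mk.injEq] at h
  omega

theorem chainExample_adj_lastLeft {k t : ℕ} (hk : 3 ≤ k) (i : Fin 3) (j : Fin t) :
    (chainExample k t).Adj (.inr j) (.inl (lastLeft hk i)) := by
  refine Adj.symm (chainExample_adj.2 (.inr ?_))
  simp only [lastLeft]
  omega

theorem connected_chainExample {k t : ℕ} (hk : 3 ≤ k) (ht : 3 ≤ t) :
    (chainExample k t).Connected := by
  rw [connected_iff_exists_forall_reachable]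
  have h0 : ∀ i : Fin k, (chainExample k t).Adj (.inr ⟨0, by omega⟩) (.inl i) :=
    fun i => Adj.symm (chainExample_adj.2 (.inl (by simp)))
  refine ⟨.inr ⟨0, by omega⟩, ?_⟩
  rintro (i | j)
  · exact (h0 i).reachable
  · exact (h0 _).reachable.trans (chainExample_adj_lastLeft hk 0 j).symm.reachable

theorem three_le_minDegree_chainExample {k t : ℕ} (hk : 3 ≤ k) (ht : 3 ≤ t) :
    3 ≤ (chainExample k t).minDegree := by
  have : Nonempty (Fin k ⊕ Fin t) := ⟨.inl ⟨0, by omega⟩⟩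
  refine three_le_minDegree ?_
  rintro (i | j)
  · exact ⟨fun a => .inr (Fin.castLE ht a), fun a b h => by simpa using h,
      fun a => chainExample_adj.2 (.inl (by simp))⟩
  · exact ⟨fun a => .inl (lastLeft hk a), Sum.inl_injective.comp (lastLeft_injective hk),
      fun a => chainExample_adj_lastLeft hk a j⟩

theorem six_le_rainbowIndex_chainExample {k t : ℕ} (hk : 3 ≤ k) (ht : 2 * 5 ^ 3 + 4 ≤ t) :
    6 ≤ rainbowIndex 3 (chainExample k t) := by
  classical
  refine le_rainbowIndex (n := 6) fun n c hc => ?_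
  by_contra! hn
  -- Only the `b`s beyond the first three have no neighbours except the last three `a`s; hence the
  -- extra 3 in the bound on `t`.
  let b : Fin (t - 3) → Fin t := fun j => ⟨j + 3, by omega⟩
  have hb : Function.Injective b := by
    intro i j h
    simp only [b, Fin.mk.injEq] at h
    omega
  obtain ⟨g, κ, hg, hκ⟩ := exists_three_of_mul_lt_card
    (fun (j : Fin (t - 3)) (i : Fin 3) =>
      c ⟨s(.inr (b j), .inl (lastLeft hk i)), chainExample_adj_lastLeft hk i (b j)⟩) (by
      have : n ^ 3 ≤ 5 ^ 3 := Nat.pow_le_pow_left (by omega) 3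
      simp
      omega)
  have hx : Function.Injective fun i => (Sum.inr (b (g i)) : Fin k ⊕ Fin t) :=
    Sum.inr_injective.comp (hb.comp hg)
  have hyi : Function.Injective fun i => (Sum.inl (lastLeft hk i) : Fin k ⊕ Fin t) :=
    Sum.inl_injective.comp (lastLeft_injective hk)
  obtain ⟨T, hT⟩ := hc _ (card_univ_image_fin_three hx)
  have hxS : ∀ i, Sum.inr (b (g i)) ∈
      Finset.univ.image fun i => (Sum.inr (b (g i)) : Fin k ⊕ Fin t) :=
    fun i => Finset.mem_image_of_mem _ (Finset.mem_univ i)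
  have hy := hT.mem_verts_of_twins hx hxS (y := fun i => .inl (lastLeft hk i))
    (fun i j => chainExample_adj_lastLeft hk j (b (g i))) (by
      rintro i (v | v) hv
      · have hv' := chainExample_adj.1 hv.symm
        have h3 : k ≤ (v : ℕ) + 3 := hv'.resolve_left (by simp [b])
        refine ⟨⟨v - (k - 3), by omega⟩, ?_⟩
        simp only [lastLeft, Sum.inl.injEq, Fin.ext_iff]
        omega
      · exact hv.elim) (fun i j => congrFun (hκ i) j)
  have hxT : ∀ i, Sum.inr (b (g i)) ∈ T.verts := fun i => hT.subset_verts (hxS i)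
  have h1 := six_le_ncard hx hyi (by simp) hxT hy
  by_cases h7 : ∃ z ∈ T.verts, (∀ i, z ≠ .inr (b (g i))) ∧ ∀ i, z ≠ .inl (lastLeft hk i)
  · obtain ⟨z, hz, hzx, hzy⟩ := h7
    have h2 := six_le_ncard (s := T.verts \ {z}) hx hyi (by simp)
      (fun i => ⟨hxT i, fun h => hzx i h.symm⟩) (fun i => ⟨hy i, fun h => hzy i h.symm⟩)
    rw [Set.ncard_sdiff_singleton_of_mem hz] at h2
    have h3 := hT.ncard_verts_le'
    omega
  -- With no seventh vertex, `T` lies in a `K_{3,3}` that carries at most three colours, so it has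
  -- at most four vertices, not six.
  · push Not at h7
    have hcol : ∀ (i : Fin k) (j : Fin t) (h : (chainExample k t).Adj (.inl i) (.inr j)),
        T.Adj (.inl i) (.inr j) → c ⟨s(.inl i, .inr j), h⟩ ∈ Finset.univ.image κ := by
      intro i j h hT'
      obtain ⟨i', hi'⟩ : ∃ i', lastLeft hk i' = i := by
        by_contra! hne
        exact (h7 _ (T.edge_vert hT') (by simp)).elim fun i' hi' =>
          hne i' (Sum.inl_injective hi').symm
      obtain ⟨j', hj'⟩ : ∃ j', b (g j') = j := by
        by_contra! hne
        obtain ⟨i'', h''⟩ := h7 _ (T.edge_vert hT'.symm)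
          (fun i'' h'' => hne i'' (Sum.inr_injective h'').symm)
        simp at h''
      subst hi' hj'
      refine Finset.mem_image.2 ⟨i', Finset.mem_univ _, ?_⟩
      rw [← congrFun (hκ j') i']
      congr 2
      exact Sym2.eq_swap
    have h2 := hT.ncard_verts_le (Finset.univ.image κ) (by
      rintro ⟨e, he⟩ heT
      induction e with
      | _ u v =>
        rcases u with i | j <;> rcases v with i' | j'
        · exact he.elim
        · exact hcol _ _ he heT
        · have := hcol _ _ he.symm (Subgraph.Adj.symm heT)
          convert this using 2
          exact Subtype.ext Sym2.eq_swap
        · exact he.elim)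
    have h3 : (Finset.univ.image κ).card ≤ 3 := Finset.card_image_le.trans (by simp)
    omega

/-! ### The windmill -/

theorem windmill_adj_none {t : ℕ} (v : Fin t × Fin 3) : (windmill t).Adj (some v) none :=
  ⟨by simp, by simp⟩

theorem windmill_adj_some {t : ℕ} {s : Fin t} {i j : Fin 3} (h : i ≠ j) :
    (windmill t).Adj (some (s, i)) (some (s, j)) := ⟨by simpa using h, by simp⟩

theorem windmill_adj_some_iff {t : ℕ} {u v : Fin t × Fin 3} :
    (windmill t).Adj (some u) (some v) ↔ u ≠ v ∧ u.1 = v.1 := by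
  simp [windmill]

theorem connected_windmill (t : ℕ) : (windmill t).Connected := by
  rw [connected_iff_exists_forall_reachable]
  refine ⟨none, ?_⟩
  rintro (_ | v)
  · exact Reachable.refl _
  · exact (windmill_adj_none v).symm.reachable

theorem three_le_minDegree_windmill {t : ℕ} (ht : 1 ≤ t) : 3 ≤ (windmill t).minDegree := by
  refine three_le_minDegree ?_
  rintro (_ | ⟨s, i⟩)
  · exact ⟨fun i => some (⟨0, ht⟩, i), fun i j h => by simpa using h,
      fun i => (windmill_adj_none _).symm⟩
  · refine ⟨![none, some (s, i + 1), some (s, i + 2)], ?_, ?_⟩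
    · intro a b h
      fin_cases a <;> fin_cases b <;> simp at h ⊢
    · intro a
      fin_cases a
      · exact windmill_adj_none _
      · exact windmill_adj_some (by decide +revert)
      · exact windmill_adj_some (by decide +revert)

theorem isIntervalGraph_windmill (t : ℕ) : IsIntervalGraph (windmill t) := by
  refine ⟨fun v => v.elim Set.univ fun x => {((x.1 : ℕ) : ℝ)}, ?_, ?_⟩
  · rintro (_ | v)
    · exact ⟨Set.univ_nonempty, Set.ordConnected_univ⟩
    · exact ⟨Set.singleton_nonempty _, Set.ordConnected_singleton⟩
  · rintro (_ | u) (_ | v) h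
    · exact absurd rfl h
    · simpa using (windmill_adj_none v).symm
    · simpa using windmill_adj_none u
    · rw [windmill_adj_some_iff]
      simp only [Option.elim_some, Set.singleton_inter_nonempty, Set.mem_singleton_iff,
        Nat.cast_inj, Fin.val_inj]
      exact and_iff_right fun h' => h (congrArg some h')

theorem diam_windmill {t : ℕ} (ht : 2 ≤ t) : (windmill t).diam = 2 := by
  have hconn := connected_windmill t
  apply le_antisymm
  · obtain ⟨u, v, huv⟩ := (windmill t).exists_dist_eq_diam
    have h0 : ∀ u, (windmill t).dist u none ≤ 1 := by
      rintro (_ | u)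
      · simp
      · exact (dist_eq_one_iff_adj.2 (windmill_adj_none u)).le
    have h1 := hconn.dist_triangle (u := u) (v := none) (w := v)
    have h2 := h0 u
    have h3 := h0 v
    rw [dist_comm] at h3
    omega
  · let u : Option (Fin t × Fin 3) := some (⟨0, by omega⟩, 0)
    let v : Option (Fin t × Fin 3) := some (⟨1, by omega⟩, 0)
    have hne : u ≠ v := by simp [u, v]
    have h1 := hconn.pos_dist_of_ne hne
    have h2 : (windmill t).dist u v ≠ 1 := by
      rw [Ne, dist_eq_one_iff_adj, windmill_adj_some_iff]
      simp
    have h3 := dist_le_diam (connected_iff_ediam_ne_top.1 hconn) (u := u) (v := v)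
    omega

/-- The edges of a copy of `K₄` in the windmill: `inl i` is the edge from the centre to the vertex
`i`, and `inr i` the edge opposite to it. -/
def bladeEdge {t : ℕ} (s : Fin t) : Fin 3 ⊕ Fin 3 → (windmill t).edgeSet
  | .inl i => ⟨s(some (s, i), none), windmill_adj_none (s, i)⟩
  | .inr i => ⟨s(some (s, i + 1), some (s, i + 2)), windmill_adj_some (by decide +revert)⟩

theorem bladeEdge_injective {t : ℕ} {s s' : Fin t} {e e' : Fin 3 ⊕ Fin 3}
    (h : bladeEdge s e = bladeEdge s' e') : s = s' ∧ e = e' := by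
  have h' := congrArg Subtype.val h
  rcases e with i | i <;> rcases e' with j | j <;>
    simp only [bladeEdge, Sym2.eq_iff, Option.some.injEq, Prod.mk.injEq, reduceCtorEq, and_false,
      false_and, and_true, or_false, or_self] at h'
  · exact ⟨h'.1, congrArg _ h'.2⟩
  · rcases h' with ⟨⟨h1, h2⟩, -⟩ | ⟨⟨h1, h2⟩, -, h3⟩
    · exact ⟨h1, congrArg _ (add_right_cancel h2)⟩
    · have e : ∀ i j : Fin 3, i + 1 = j + 2 → i + 2 ≠ j + 1 := by decide
      exact absurd h3 (e i j h2)

/-- The three listed edges are those of the blade at the vertex `p`: its spoke and the edges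
opposite to the other two rim vertices. -/
theorem exists_bladeEdge_mem {t : ℕ} {T : (windmill t).Subgraph} {s : Fin t} {p : Fin 3}
    {v : Option (Fin t × Fin 3)} (h : T.Adj (some (s, p)) v) :
    ∃ k, ((bladeEdge s (![.inl p, .inr (p + 1), .inr (p + 2)] k) : (windmill t).edgeSet) :
      Sym2 (Option (Fin t × Fin 3))) ∈ T.edgeSet := by
  rcases v with _ | ⟨s', j⟩
  · exact ⟨0, h⟩
  · obtain ⟨h1, h2⟩ := windmill_adj_some_iff.1 (T.adj_sub h)
    obtain rfl : s = s' := h2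
    have hj : j ≠ p := fun h' => h1 (by rw [h'])
    have e : ∀ p j : Fin 3, j ≠ p → j = p + 1 ∨ j = p + 2 := by decide
    have e1 : ∀ p : Fin 3, p + 1 + 1 = p + 2 := by decide
    have e2 : ∀ p : Fin 3, p + 1 + 2 = p := by decide
    have e3 : ∀ p : Fin 3, p + 2 + 1 = p := by decide
    have e4 : ∀ p : Fin 3, p + 2 + 2 = p + 1 := by decide
    rcases e p j hj with rfl | rfl
    · refine ⟨2, ?_⟩
      change s(some (s, p + 2 + 1), some (s, p + 2 + 2)) ∈ T.edgeSet
      rw [e3, e4]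
      exact h
    · refine ⟨1, ?_⟩
      change s(some (s, p + 1 + 1), some (s, p + 1 + 2)) ∈ T.edgeSet
      rw [e1, e2]
      exact Subgraph.Adj.symm h

theorem exists_inl_mem {t : ℕ} {T : (windmill t).Subgraph} (hT : T.coe.Connected) {s s' : Fin t}
    {p : Fin 3} (hs : s ≠ s') (h : some (s, p) ∈ T.verts) (h' : some (s', p) ∈ T.verts) :
    ∃ i, ((bladeEdge s (.inl i) : (windmill t).edgeSet) :
      Sym2 (Option (Fin t × Fin 3))) ∈ T.edgeSet := by
  obtain ⟨x, ⟨i, rfl⟩, y, hy, hxy⟩ := exists_adj_of_connected hT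
    (A := Set.range fun i => some (s, i)) h ⟨p, rfl⟩ h' (by simp [hs])
  rcases y with _ | ⟨r, j⟩
  · exact ⟨i, hxy⟩
  · obtain ⟨-, h2⟩ := windmill_adj_some_iff.1 (T.adj_sub hxy)
    obtain rfl : s = r := h2
    exact absurd ⟨j, rfl⟩ hy

/-- A rainbow tree through the vertices `p` of three equally coloured copies of `K₄` shows that
the edges of such a copy other than the one opposite to `p` have distinct colours. -/
theorem injOn_of_equal_blades {t n : ℕ} {c : (windmill t).edgeSet → Fin n} {S : Finset _}
    {T : (windmill t).Subgraph} (hT : IsRainbowTree c S T) {g : Fin 3 → Fin t}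
    (hg : Function.Injective g) {κ : Fin 3 ⊕ Fin 3 → Fin n}
    (hκ : ∀ a e, c (bladeEdge (g a) e) = κ e) {p : Fin 3} (hS : ∀ a, some (g a, p) ∈ S) :
    Set.InjOn κ {e | e ≠ .inr p} := by
  have hv : ∀ a, some (g a, p) ∈ T.verts := fun a => hT.subset_verts (hS a)
  have hrb : ∀ a a' e e',
      ((bladeEdge (g a) e : (windmill t).edgeSet) : Sym2 _) ∈ T.edgeSet →
      ((bladeEdge (g a') e' : (windmill t).edgeSet) : Sym2 _) ∈ T.edgeSet → κ e = κ e' →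
      a = a' ∧ e = e' := by
    intro a a' e e' h h' hee
    have := bladeEdge_injective (hT.isRainbow _ _ h h' (by rw [hκ, hκ, hee]))
    exact ⟨hg this.1, this.2⟩
  have h1 : ∀ a, ∃ k,
      ((bladeEdge (g a) (![.inl p, .inr (p + 1), .inr (p + 2)] k) : (windmill t).edgeSet) :
        Sym2 _) ∈ T.edgeSet := by
    intro a
    obtain ⟨a', ha'⟩ := exists_ne a
    obtain ⟨x, rfl, y, -, hxy⟩ := exists_adj_of_connected hT.isTree.connected
      (A := {some (g a, p)}) (hv a) rfl (hv a') (by simpa using fun h => ha' (hg h))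
    exact exists_bladeEdge_mem hxy
  have h2 : ∀ a, ∃ i, ((bladeEdge (g a) (.inl i) : (windmill t).edgeSet) : Sym2 _) ∈ T.edgeSet := by
    intro a
    obtain ⟨a', ha'⟩ := exists_ne a
    exact exists_inl_mem hT.isTree.connected (fun h => ha' (hg h).symm) (hv a) (hv a')
  choose σ hσ using h1
  choose τ hτ using h2
  -- Equally coloured blades must contribute different edges to `T`, so the three blades exhaust the
  -- three edges at `p`, and likewise the three spokes.
  have hσs : Function.Surjective σ := Finite.surjective_of_injective fun a a' h =>
    (hrb a a' _ _ (hσ a) (hσ a') (by rw [h])).1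
  have hτs : Function.Surjective τ := Finite.surjective_of_injective fun a a' h =>
    (hrb a a' _ _ (hτ a) (hτ a') (by rw [h])).1
  have hall : ∀ e, e ≠ .inr p →
      ∃ a, ((bladeEdge (g a) e : (windmill t).edgeSet) : Sym2 _) ∈ T.edgeSet := by
    rintro (i | i) hi
    · obtain ⟨a, rfl⟩ := hτs i
      exact ⟨a, hτ a⟩
    · have hip : i ≠ p := fun h => hi (by rw [h])
      have e : ∀ p j : Fin 3, j ≠ p → j = p + 1 ∨ j = p + 2 := by decide
      rcases e p i hip with rfl | rfl
      · obtain ⟨a, ha⟩ := hσs 1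
        have := hσ a
        rw [ha] at this
        exact ⟨a, this⟩
      · obtain ⟨a, ha⟩ := hσs 2
        have := hσ a
        rw [ha] at this
        exact ⟨a, this⟩
  intro e he e' he' hee
  obtain ⟨a, ha⟩ := hall e he
  obtain ⟨a', ha'⟩ := hall e' he'
  exact (hrb a a' e e' ha ha' hee).2

theorem six_le_rainbowIndex_windmill {t : ℕ} (ht : 2 * 5 ^ 6 + 1 ≤ t) :
    6 ≤ rainbowIndex 3 (windmill t) := by
  classical
  refine le_rainbowIndex (n := 6) fun n c hc => ?_
  obtain hn | hn := le_or_gt 6 n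
  · exact hn
  obtain ⟨g, κ, hg, hκ⟩ := exists_three_of_mul_lt_card
    (fun (s : Fin t) (e : Fin 3 ⊕ Fin 3) => c (bladeEdge s e)) (by
      have : n ^ 6 ≤ 5 ^ 6 := Nat.pow_le_pow_left (by omega) 6
      simp
      omega)
  have key : ∀ p : Fin 3, Set.InjOn κ {e | e ≠ .inr p} := by
    intro p
    have hx : Function.Injective fun a => (some (g a, p) : Option (Fin t × Fin 3)) := by
      intro a a' h
      exact hg (by simpa using h)
    obtain ⟨T, hT⟩ := hc _ (card_univ_image_fin_three hx)
    exact injOn_of_equal_blades hT hg (fun a e => congrFun (hκ a) e)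
      (fun a => Finset.mem_image_of_mem _ (Finset.mem_univ a))
  -- Each `p` separates all edges of a blade but the opposite one. Two edges exclude at most two
  -- values of `p`, so a third value separates them and all six colours are distinct.
  have hinj : Function.Injective κ := by
    intro e e' h
    have hp : ∀ e e' : Fin 3 ⊕ Fin 3, ∃ p : Fin 3, e ≠ .inr p ∧ e' ≠ .inr p := by decide
    obtain ⟨p, h1, h2⟩ := hp e e'
    exact key p h1 h2 h
  simpa using Fintype.card_le_of_injective κ hinj

end RainbowIndex

/-! ### The main theorem -/

theorem mainTheorem5 :
    -- the bounds
    (∀ (V : Type*) [Fintype V] (G : SimpleGraph V) [DecidableRel G.Adj],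
      G.Connected → 3 ≤ G.minDegree →
        (RainbowIndex.IsThresholdGraph G → RainbowIndex.rainbowIndex 3 G ≤ 5) ∧
        (RainbowIndex.IsChainGraph G → RainbowIndex.rainbowIndex 3 G ≤ 6) ∧
        (RainbowIndex.IsIntervalGraph G →
          (G.diam : ℕ∞) ≤ RainbowIndex.rainbowIndex 3 G ∧
          RainbowIndex.rainbowIndex 3 G ≤ (G.diam : ℕ∞) + 4)) ∧
    -- the three upper bounds are attained
    (∀ t : ℕ, 2 * 4 ^ 3 + 1 ≤ t →
      (RainbowIndex.thresholdExample t).Connected ∧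
      3 ≤ (RainbowIndex.thresholdExample t).minDegree ∧
      RainbowIndex.IsThresholdGraph (RainbowIndex.thresholdExample t) ∧
      RainbowIndex.rainbowIndex 3 (RainbowIndex.thresholdExample t) = 5) ∧
    (∀ k t : ℕ, 3 ≤ k → 2 * 5 ^ 3 + 4 ≤ t →
      (RainbowIndex.chainExample k t).Connected ∧
      3 ≤ (RainbowIndex.chainExample k t).minDegree ∧
      RainbowIndex.IsChainGraph (RainbowIndex.chainExample k t) ∧
      RainbowIndex.rainbowIndex 3 (RainbowIndex.chainExample k t) = 6) ∧
    (∀ t : ℕ, 2 * 5 ^ 6 + 1 ≤ t →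
      (RainbowIndex.windmill t).Connected ∧
      3 ≤ (RainbowIndex.windmill t).minDegree ∧
      RainbowIndex.IsIntervalGraph (RainbowIndex.windmill t) ∧
      (RainbowIndex.windmill t).diam = 2 ∧
      RainbowIndex.rainbowIndex 3 (RainbowIndex.windmill t) =
        ((RainbowIndex.windmill t).diam : ℕ∞) + 4) := by
  open RainbowIndex in
  refine ⟨?_, ?_, ?_, ?_⟩
  · intro V _ G _ hconn hδ
    have hnb := exists_adj_ne_ne hδ
    have := hconn.nonempty
    refine ⟨fun h => h.rainbowIndex_le hnb, fun h => h.rainbowIndex_le hnb,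
      fun h => ⟨diam_le_rainbowIndex ?_, h.rainbowIndex_le hconn hnb⟩⟩
    exact hδ.trans ((G.minDegree_le_degree (Classical.arbitrary V)).trans
      (Finset.card_le_univ _))
  · intro t ht
    have hδ := three_le_minDegree_thresholdExample (t := t) (by omega)
    have hthr := isThresholdGraph_thresholdExample t
    exact ⟨connected_thresholdExample t, hδ, hthr, le_antisymm
      (hthr.rainbowIndex_le (exists_adj_ne_ne hδ)) (five_le_rainbowIndex_thresholdExample ht)⟩
  · intro k t hk ht
    have hδ := three_le_minDegree_chainExample (t := t) hk (by omega)
    have hchain := isChainGraph_chainExample k t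
    have hconn := connected_chainExample (t := t) hk (by omega)
    have := hconn.nonempty
    exact ⟨hconn, hδ, hchain, le_antisymm
      (hchain.rainbowIndex_le (exists_adj_ne_ne hδ)) (six_le_rainbowIndex_chainExample hk ht)⟩
  · intro t ht
    have hδ := three_le_minDegree_windmill (t := t) (by omega)
    have hint := isIntervalGraph_windmill t
    have hdiam := diam_windmill (t := t) (by omega)
    have hconn := connected_windmill t
    refine ⟨hconn, hδ, hint, hdiam, le_antisymm
      (hint.rainbowIndex_le hconn (exists_adj_ne_ne hδ)) ?_⟩
    rw [hdiam]
    have h6 := six_le_rainbowIndex_windmill ht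
    norm_num
    exact h6
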